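/- Consider the maps of the plane $M_f:(q,p)\mapsto(p,\,-q+f(p))$ with a real parameter $a$ and, writing $K_0=p^2-a\,pq+q^2$, the following force functions and invariants. Sextupole (SX): $f(p)=-p\,\frac{p-a}{p+1}$, $K=K_0+p^2q+pq^2$. Focusing octupole (FO): $f(p)=\frac{a\,p}{1+p^2}$, $K=K_0+p^2q^2$. Defocusing octupole (DO): $f(p)=\frac{a\,p}{1-p^2}$, $K=K_0-p^2q^2$. Duffing regime (Df): the map and the invariant of FO with $a>2$. Let $z_0$ be a fixed point of $M_f$. For small $h>0$ let $D_h$ be the connected component of $\{K<K(z_0)+h\}$ that contains $z_0$, and let $C_h=\partial D_h$. The action of $C_h$ is $J=\frac1{2\pi}\,\mathrm{area}(D_h)=\frac1{2\pi}\oint_{C_h}p\,dq$ (the curve traversed clockwise in the $(q,p)$-plane). The detuning at $z_0$ is the (one-sided) derivative at $J=0$ of the function $\nu(J)$, where for small $J>0$ the value $\nu(J)\in[0,1)$ is the Poincaré rotation number of $M_f$ (clockwise turns per iteration) on the curve $C_h$ of action $J$, and $\nu(0)=\nu_0$. Then, for all sufficiently small $h>0$, $C_h$ is a simple closed curve around $z_0$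 which is invariant under $M_f$, the action is a bijection from an interval of heights $(0,h_0)$ onto an interval $(0,\delta)$, and the detuning exists and is given as follows. (1) If $-2<a<2$, $z_0=(0,0)$ and $\nu_0=\frac1{2\pi}\arccos\frac a2$, then for FO (sign $+$) and DO (sign $-$) $$\frac{d\nu}{dJ}\Big|_{J=0}=\pm\frac{3}{2\pi}\,\frac{a}{4-a^2}=\pm\frac{3}{4\pi}\,\frac{\cot(2\pi\nu_0)}{\sin(2\pi\nu_0)}.$$ (2) If $-2<a<2$, $z_0=(0,0)$ and $\nu_0=\frac1{2\pi}\arccos\frac a2$, then for SX $$\frac{d\nu}{dJ}\Big|_{J=0}=-\frac{1}{2\pi}\,\frac{(1+a)(8+a)}{(2+a)(2-a)^2}=-\frac{1}{32\pi}\,\frac{8\sin(2\pi\nu_0)+\sin(4\pi\nu_0)}{\sin^3(\pi\nu_0)\,\sin^3(2\pi\nu_0)}\,\sin(3\pi\nu_0).$$ (3) If $a>2$, $z_0=\pm\sqrt{\tfrac{a-2}{2}}\,(1,1)$ (either sign) and $\nu_0=\frac1{2\pi}\arccos\left(\frac4a-1\right)$, then for Df $$\frac{d\nu}{dJ}\Big|_{J=0}=\frac{1}{2\pi}\,\frac{4+a}{a\,(2-a)}=-\frac{1}{4\pi}\,\frac{2+\cos(2\pi\nu_0)}{\tan^2(\pi\nu_0)}.$$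 -/

import Mathlib

open Real Set

noncomputable section

namespace McMillan

/-! Phase-space points are pairs `z = (q, p)`, so that `z.1` is the coordinate and `z.2` is the
momentum. The parameter `a` is the trace of the linear part of the map at the origin. -/

/-- Quadratic part of the invariants: `p² - a p q + q²`. -/
def K0 (a : ℝ) (z : ℝ × ℝ) : ℝ := z.2 ^ 2 - a * z.2 * z.1 + z.1 ^ 2

/-- Invariant of the McMillan sextupole. -/
def Ksxt (a : ℝ) (z : ℝ × ℝ) : ℝ := K0 a z + (z.2 ^ 2 * z.1 + z.2 * z.1 ^ 2)

/-- Invariant of the focusing McMillan octupole. -/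
def KoctPlus (a : ℝ) (z : ℝ × ℝ) : ℝ := K0 a z + z.2 ^ 2 * z.1 ^ 2

/-- Invariant of the defocusing McMillan octupole. -/
def KoctMinus (a : ℝ) (z : ℝ × ℝ) : ℝ := K0 a z - z.2 ^ 2 * z.1 ^ 2

/-- Force function of the McMillan sextupole (normalized to `Γ = 1`, `a = -2 ε / Γ`). -/
def fsxt (a p : ℝ) : ℝ := -p * ((p - a) / (p + 1))

/-- Force function of the focusing McMillan octupole (normalized to `Γ = 1`). -/
def foctPlus (a p : ℝ) : ℝ := a * p / (1 + p ^ 2)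

/-- Force function of the defocusing McMillan octupole (normalized to `Γ = -1`). -/
def foctMinus (a p : ℝ) : ℝ := a * p / (1 - p ^ 2)

/-- The map in McMillan form with force function `f`: `q' = p`, `p' = -q + f(p)`. -/
def stdMap (f : ℝ → ℝ) (z : ℝ × ℝ) : ℝ × ℝ := (z.2, -z.1 + f z.2)

/-- The region around `z₀` bounded by the invariant curve at height `h` above the level of `z₀`:
the connected component containing `z₀` of `{z | K z < K z₀ + h}`. -/
def region (K : ℝ × ℝ → ℝ) (z₀ : ℝ × ℝ) (h : ℝ) : Set (ℝ × ℝ) :=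
  connectedComponentIn {z | K z < K z₀ + h} z₀

/-- The invariant curve around `z₀` at height `h` above the level of `z₀`. -/
def curve (K : ℝ × ℝ → ℝ) (z₀ : ℝ × ℝ) (h : ℝ) : Set (ℝ × ℝ) :=
  frontier (region K z₀ h)

/-- The canonical action of that curve: the phase-space area that it encloses over `2π`, that is,
`(2π)⁻¹ ∮ p dq` along the curve traversed clockwise in the `(q, p)`-plane. -/
def action (K : ℝ × ℝ → ℝ) (z₀ : ℝ × ℝ) (h : ℝ) : ℝ :=
  (MeasureTheory.volume (region K z₀ h)).toReal / (2 * π)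

/-- `γ`, considered modulo `1`, is a parametrization of the simple closed curve `C` which winds
once clockwise (the direction of the Hamiltonian flow around a minimum) around `z₀`. -/
structure IsClockwiseParam (γ : ℝ → ℝ × ℝ) (C : Set (ℝ × ℝ)) (z₀ : ℝ × ℝ) : Prop where
  continuous : Continuous γ
  periodic : Function.Periodic γ 1
  injOn : InjOn γ (Ico 0 1)
  range_eq : range γ = C
  winding : ∃ r φ : ℝ → ℝ, Continuous φ ∧ (∀ t, 0 < r t) ∧ (∀ t, φ (t + 1) = φ t + 2 * π) ∧
    ∀ t, γ t = z₀ + r t • (cos (φ t), -sin (φ t))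

/-- The closed curve `C` around `z₀` is mapped to itself by `M`, and the Poincaré rotation number
of `M` on `C` (clockwise turns around `z₀` per iteration, the representative in `[0, 1)`) is `ρ`:
in a clockwise parametrization of `C`, the map `M` has a lift `F` to the real line, monotone and
commuting with `t ↦ t + 1`, such that `(F^n t) / n → ρ`. -/
def HasRotationNumber (M : ℝ × ℝ → ℝ × ℝ) (C : Set (ℝ × ℝ)) (z₀ : ℝ × ℝ) (ρ : ℝ) : Prop :=
  ρ ∈ Ico (0 : ℝ) 1 ∧ ∃ γ : ℝ → ℝ × ℝ, IsClockwiseParam γ C z₀ ∧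
    ∃ F : CircleDeg1Lift, (∀ t, M (γ t) = γ (F t)) ∧ F.translationNumber = ρ

/-- Near its fixed point `z₀`, the map `M` with invariant `K` has an amplitude-frequency dependence
`ν(J)` with `ν(0) = ν₀` and detuning `dν/dJ = c` at `J = 0`. The invariant curves at small heights
correspond bijectively to the small positive values of the action, and `ν(J)` is the rotation number
of `M` on the curve of action `J`. As `J ≥ 0`, the derivative at `J = 0` is one-sided. -/
def HasDetuning (M : ℝ × ℝ → ℝ × ℝ) (K : ℝ × ℝ → ℝ) (z₀ : ℝ × ℝ) (ν₀ c : ℝ) : Prop :=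
  M z₀ = z₀ ∧ ∃ h₀ > 0, ∃ δ > 0, ∃ ν : ℝ → ℝ,
    BijOn (action K z₀) (Ioo 0 h₀) (Ioo 0 δ) ∧
    (∀ h ∈ Ioo 0 h₀, HasRotationNumber M (curve K z₀ h) z₀ (ν (action K z₀ h))) ∧
    ν 0 = ν₀ ∧ HasDerivWithinAt ν c (Ici 0) 0

/-- Linear rotation number (tune) at the origin: `(2π)⁻¹ arccos (a / 2)`. -/
def tune (a : ℝ) : ℝ := arccos (a / 2) / (2 * π)

/-- Linear rotation number (tune) at the fixed points `± √((a - 2) / 2) (1, 1)` of the focusing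
octupole in the Duffing regime. -/
def tuneDuffing (a : ℝ) : ℝ := arccos (4 / a - 1) / (2 * π)

/-- The fixed point `√((a - 2) / 2) (1, 1)` of the focusing octupole in the Duffing regime. -/
def duffingPoint (a : ℝ) : ℝ × ℝ := (√((a - 2) / 2), √((a - 2) / 2))

end McMillan

end

namespace McMillan

open Asymptotics Filter Topology ComplexConjugate

/-! ### The canonical family of McMillan maps -/

/-! All the maps belong to one integrable family, `stdMap (fcan a A B)` with invariant `Kcan a A B`:
the sextupole is `(A, B) = (0, 1)`, the octupoles are `(±1, 0)`, and around a Duffing point the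
focusing octupole is again a member, of trace `8 / a - 2`, up to a translation and a constant factor
in the invariant. One computation at an elliptic origin, with `a = 2 cos θ`, therefore suffices.

In the coordinate `w = toC θ z` the linear part is multiplication by `l = exp (i θ)`, and `K0 =
|w|²`. A cubic polynomial change of variable `nf` conjugates the map to `nf ↦ l * nf * (1 + i κ K0)`
up to `O(|w|⁴)`, with `κ = twist θ A B` (`nf_stdMap_isBigO`). The resonances `l³ = 1` and `l⁴ = 1`
are harmless: the integrable force supplies numerators that cancel the small divisors.

On the curve of height `h` one has `K0 = h + O(h^(3/2))`, so each step advances the argument of `nf`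
by `θ + κ h + O(h^(3/2))`. That argument differs from the elliptic polar angle by a bounded
function, so both have the same mean advance, which is `2π` times the rotation number
(`exists_hasRotationNumber`, `eventually_hasRotationNumber`).

The region is squeezed between two ellipses of `K0`, whence `2 sin θ * J = h + O(h^(3/2))`
(`exists_action_bound`). Eliminating `h` gives `dν/dJ = 2 sin θ * κ / (2π)`
(`hasDetuning_of_expansions`, `hasDetuning_Kcan`). The topology of the region and the monotonicity
and continuity of `h ↦ J` all rest on `t³ K z ≤ K (t z) ≤ t K z` for `0 ≤ t ≤ 1` near the origin. -/

/-- The canonical biquadratic invariant; `A = 0` is the sextupole, `B = 0` the octupoles. -/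
noncomputable def Kcan (a A B : ℝ) (z : ℝ × ℝ) : ℝ :=
  K0 a z + B * (z.2 ^ 2 * z.1 + z.2 * z.1 ^ 2) + A * (z.2 ^ 2 * z.1 ^ 2)

/-- The force function belonging to the invariant `Kcan`. -/
noncomputable def fcan (a A B p : ℝ) : ℝ := p * (a - B * p) / (1 + B * p + A * p ^ 2)

/-- The complex linear coordinate in which the linear part of the map is a rotation. -/
noncomputable def toC (θ : ℝ) (z : ℝ × ℝ) : ℂ := ⟨z.2 - cos θ * z.1, sin θ * z.1⟩

/-- The coefficient of `K0` in the phase advance (in radians). -/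
noncomputable def twist (θ A B : ℝ) : ℝ :=
  (3 * A * (2 * cos θ) / (4 - (2 * cos θ) ^ 2) -
    B ^ 2 * ((1 + 2 * cos θ) * (8 + 2 * cos θ) / ((2 + 2 * cos θ) * (2 - 2 * cos θ) ^ 2))) /
    (2 * sin θ)

lemma norm_toC_sq (θ : ℝ) (z : ℝ × ℝ) : ‖toC θ z‖ ^ 2 = K0 (2 * cos θ) z := by
  rw [← Complex.normSq_eq_norm_sq, Complex.normSq_mk, toC, K0]
  linear_combination (z.1 ^ 2) * (sin_sq_add_cos_sq θ)

lemma toC_smul (θ t : ℝ) (z : ℝ × ℝ) : toC θ (t • z) = t * toC θ z := by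
  apply Complex.ext <;> simp [toC] <;> ring

@[fun_prop]
lemma continuous_toC (θ : ℝ) : Continuous (toC θ) := by
  have : toC θ = fun z : ℝ × ℝ => ((z.2 - cos θ * z.1 : ℝ) : ℂ) + (sin θ * z.1 : ℝ) * Complex.I := by
    funext z; apply Complex.ext <;> simp [toC, -Complex.ofReal_cos, -Complex.ofReal_sin]
  rw [this]
  fun_prop

lemma abs_fst_le (θ : ℝ) (hs : 0 < sin θ) (z : ℝ × ℝ) : |z.1| ≤ (sin θ)⁻¹ * ‖toC θ z‖ := by
  have h := Complex.abs_im_le_norm (toC θ z)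
  simp only [toC] at h
  rw [abs_mul, abs_of_pos hs] at h
  rw [inv_mul_eq_div, le_div_iff₀ hs, mul_comm]; exact h

lemma abs_snd_le (θ : ℝ) (hs : 0 < sin θ) (z : ℝ × ℝ) : |z.2| ≤ (sin θ)⁻¹ * ‖toC θ z‖ := by
  rw [inv_mul_eq_div, le_div_iff₀ hs, mul_comm]
  have h : (sin θ * z.2) ^ 2 ≤ ‖toC θ z‖ ^ 2 := by
    rw [norm_toC_sq, K0]
    nlinarith [sq_nonneg (z.1 - cos θ * z.2), sin_sq_add_cos_sq θ]
  have := abs_le_of_sq_le_sq h (norm_nonneg _)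
  rwa [abs_mul, abs_of_pos hs] at this

/-! ### Algebra of the normal form -/

section Algebra

variable {l w v A B : ℂ}

/-- Homological equation in degree two, with momentum `(l w - l⁻¹ v) / (l - l⁻¹)`. The divisor of
`v²` is `l⁻² - l`, which contains `l² + l + 1`; the quadratic force coefficient contains it too, and
the quotient is regular at `l³ = 1`. -/
lemma normalForm_order_two (hl : l ≠ 0) (h1 : l - 1 ≠ 0) (h2 : l + 1 ≠ 0) :
    (-(l ^ 2 + l + 1) * B / l) * ((l * w - l⁻¹ * v) / (l - l⁻¹)) ^ 2
    + (l ^ 2 + l + 1) * B / ((l - l⁻¹) ^ 2 * (l - 1)) * ((l * w) ^ 2 - l * w ^ 2)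
    + 2 * (l ^ 2 + l + 1) * B / (l * (l - l⁻¹) ^ 2 * (l - 1)) * (l * w * (l⁻¹ * v) - l * (w * v))
    + -B / (l * (l - l⁻¹) ^ 2 * (l - 1)) * ((l⁻¹ * v) ^ 2 - l * v ^ 2) = 0 := by
  have hD : l - l⁻¹ = (l - 1) * (l + 1) / l := by field_simp; ring
  rw [hD]
  field_simp
  ring

/-- Homological equation in degree three. The first product is the quadratic kick fed through the
quadratic part of the transformation; it equals `E * ((l² + l + 1) w + l⁻¹ v) * (l w - l⁻¹ v)²`,
which explains `E`. The monomial `w² v` has divisor zero and cannot be removed: it is the twist. The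
divisor `l⁻³ - l` of `v³` loses its factor `l² + 1` to the numerator. -/
lemma normalForm_order_three {f3 E D : ℂ} (hl : l ≠ 0) (h1 : l - 1 ≠ 0) (h2 : l + 1 ≠ 0)
    (hD : D = (l - 1) * (l + 1) / l) (hf : f3 = (l ^ 2 + l + 1) / l * B ^ 2 - (l + l⁻¹) * A)
    (hE : E = -2 * (l ^ 2 + l + 1) * B ^ 2 * (l + 1) / (l * D ^ 4 * (l - 1))) :
    (-(l ^ 2 + l + 1) * B / l) * ((l * w - l⁻¹ * v) / D) ^ 2 *
      ((l ^ 2 + l + 1) * B / (D ^ 2 * (l - 1)) * (2 * l * w)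
      + 2 * (l ^ 2 + l + 1) * B / (l * D ^ 2 * (l - 1)) * (l * w + l⁻¹ * v)
      + -B / (l * D ^ 2 * (l - 1)) * (2 * l⁻¹ * v))
    + f3 * ((l * w - l⁻¹ * v) / D) ^ 3
    + -(E * (l ^ 2 + l + 1) + f3 * l / D ^ 3) / D * ((l * w) ^ 3 - l * w ^ 3)
    + (E * (-2 * l⁻¹ + l⁻¹ ^ 2 * (l ^ 2 + l + 1)) + 3 * l⁻¹ * f3 / D ^ 3) / D *
        (l * w * (l⁻¹ * v) ^ 2 - l * (w * v ^ 2))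
    + -((l ^ 2 + l + 1) * B ^ 2 / (l - 1) ^ 2 - A) / (D ^ 4 * l ^ 2) * ((l⁻¹ * v) ^ 3 - l * v ^ 3)
    - l * w * ((E * (l - 2 * (l ^ 2 + l + 1)) - 3 * l * f3 / D ^ 3) / l * (w * v)) = 0 := by
  subst hE hf hD
  field_simp
  ring

lemma normalForm_twist {f3 E D : ℂ} (hl : l ≠ 0) (h1 : l - 1 ≠ 0) (h2 : l + 1 ≠ 0)
    (hD : D = (l - 1) * (l + 1) / l) (hf : f3 = (l ^ 2 + l + 1) / l * B ^ 2 - (l + l⁻¹) * A)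
    (hE : E = -2 * (l ^ 2 + l + 1) * B ^ 2 * (l + 1) / (l * D ^ 4 * (l - 1))) :
    (E * (l - 2 * (l ^ 2 + l + 1)) - 3 * l * f3 / D ^ 3) / l =
      -(3 * A * (l + l⁻¹) / (4 - (l + l⁻¹) ^ 2) - B ^ 2 * ((1 + (l + l⁻¹)) * (8 + (l + l⁻¹)) /
        ((2 + (l + l⁻¹)) * (2 - (l + l⁻¹)) ^ 2))) / D := by
  have e1 : 2 + (l + l⁻¹) = (l + 1) ^ 2 / l := by field_simp; ring
  have e2 : 2 - (l + l⁻¹) = -(l - 1) ^ 2 / l := by field_simp; ring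
  have e3 : 4 - (l + l⁻¹) ^ 2 = -((l + 1) ^ 2 / l * ((l - 1) ^ 2 / l)) := by field_simp; ring
  rw [e1, e2, e3]
  subst hE hf hD
  field_simp
  ring

end Algebra

end McMillan

namespace McMillan

open Asymptotics Filter Topology ComplexConjugate

/-! ### The normal form to third order -/

section NormalForm

lemma isBigO_pow_mul {g : ℝ × ℝ → ℝ} {f f' : ℝ × ℝ → ℂ} {m n k : ℕ} {F : Filter (ℝ × ℝ)}
    (h : f =O[F] fun z => g z ^ m) (h' : f' =O[F] fun z => g z ^ n) (hk : m + n = k) :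
    (fun z => f z * f' z) =O[F] fun z => g z ^ k := by
  subst hk
  simpa only [pow_add] using h.mul h'

lemma isBigO_pow_mono {g : ℝ × ℝ → ℝ} {f : ℝ × ℝ → ℂ} {m k : ℕ} {F : Filter (ℝ × ℝ)}
    (hg : Tendsto g F (𝓝 0)) (h : f =O[F] fun z => g z ^ m) (hk : k ≤ m) :
    f =O[F] fun z => g z ^ k := by
  refine h.trans ?_
  obtain ⟨j, rfl⟩ := Nat.exists_eq_add_of_le hk
  have h1 : (fun z => g z ^ j) =O[F] fun _ => (1 : ℝ) := (hg.pow j).isBigO_one ℝ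
  simpa only [pow_add, mul_one] using (isBigO_refl (fun z => g z ^ k) F).mul h1

variable (θ A B : ℝ)

/-- The linear multiplier `exp (i θ)`. -/
noncomputable def mult : ℂ := Complex.exp (θ * Complex.I)

/-- The quadratic part of the normalizing transformation. -/
noncomputable def nfQuad (w v : ℂ) : ℂ :=
  let l := mult θ
  let D := l - l⁻¹
  (l ^ 2 + l + 1) * B / (D ^ 2 * (l - 1)) * w ^ 2
    + 2 * (l ^ 2 + l + 1) * B / (l * D ^ 2 * (l - 1)) * (w * v)
    + -B / (l * D ^ 2 * (l - 1)) * v ^ 2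

/-- The cubic part of the normalizing transformation. -/
noncomputable def nfCubic (w v : ℂ) : ℂ :=
  let l := mult θ
  let D := l - l⁻¹
  let f3 := (l ^ 2 + l + 1) / l * B ^ 2 - (l + l⁻¹) * A
  let E := -2 * (l ^ 2 + l + 1) * B ^ 2 * (l + 1) / (l * D ^ 4 * (l - 1));
  -(E * (l ^ 2 + l + 1) + f3 * l / D ^ 3) / D * w ^ 3
    + (E * (-2 * l⁻¹ + l⁻¹ ^ 2 * (l ^ 2 + l + 1)) + 3 * l⁻¹ * f3 / D ^ 3) / D * (w * v ^ 2)
    + -((l ^ 2 + l + 1) * B ^ 2 / (l - 1) ^ 2 - A) / (D ^ 4 * l ^ 2) * v ^ 3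

/-- The normalized complex coordinate, a polynomial in the coordinates `z`. -/
noncomputable def nf (z : ℝ × ℝ) : ℂ :=
  toC θ z + nfQuad θ B (toC θ z) (conj (toC θ z)) + nfCubic θ A B (toC θ z) (conj (toC θ z))

variable {θ}

lemma mult_ne_zero : mult θ ≠ 0 := Complex.exp_ne_zero _

lemma mult_eq : mult θ = cos θ + sin θ * Complex.I := by
  rw [mult, Complex.exp_mul_I]; simp

lemma mult_inv_eq : (mult θ)⁻¹ = cos θ - sin θ * Complex.I := by
  rw [mult, ← Complex.exp_neg, ← neg_mul, Complex.exp_mul_I]; simp [sub_eq_add_neg]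

lemma mult_sub_one_ne (hs : 0 < sin θ) : mult θ - 1 ≠ 0 := by
  intro h
  have := congrArg Complex.im h
  simp [mult_eq, -Complex.ofReal_cos, -Complex.ofReal_sin] at this
  exact hs.ne' this

lemma mult_add_one_ne (hs : 0 < sin θ) : mult θ + 1 ≠ 0 := by
  intro h
  have := congrArg Complex.im h
  simp [mult_eq, -Complex.ofReal_cos, -Complex.ofReal_sin] at this
  exact hs.ne' this

lemma mult_sub_inv : mult θ - (mult θ)⁻¹ = 2 * sin θ * Complex.I := by
  rw [mult_eq, ← mult_eq, mult_inv_eq, mult_eq]; ring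

lemma mult_add_inv : mult θ + (mult θ)⁻¹ = (2 * cos θ : ℝ) := by
  rw [mult_inv_eq, mult_eq]; push_cast; ring

lemma conj_mult : conj (mult θ) = (mult θ)⁻¹ := by
  rw [mult_inv_eq, mult_eq]
  simp [-Complex.ofReal_cos, -Complex.ofReal_sin, sub_eq_add_neg]

/-- The nonlinear kick changes only `p`, so it is a real summand of `w` and adds equally to its
conjugate. Since `toC` reverses orientation, multiplication by `mult θ` is a clockwise turn in the
`(q, p)`-plane. -/
lemma toC_stdMap (f : ℝ → ℝ) (z : ℝ × ℝ) :
    toC θ (stdMap f z) = mult θ * toC θ z + ((f z.2 - 2 * cos θ * z.2 : ℝ) : ℂ) := by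
  rw [mult_eq]
  apply Complex.ext
  · simp [toC, stdMap, -Complex.ofReal_cos, -Complex.ofReal_sin]
    linear_combination z.1 * (sin_sq_add_cos_sq θ)
  · simp [toC, stdMap, -Complex.ofReal_cos, -Complex.ofReal_sin]
    ring

lemma snd_eq_toC (hs : 0 < sin θ) (z : ℝ × ℝ) :
    (z.2 : ℂ) = (mult θ * toC θ z - (mult θ)⁻¹ * conj (toC θ z)) / (mult θ - (mult θ)⁻¹) := by
  have hs' : (sin θ : ℂ) ≠ 0 := by exact_mod_cast hs.ne'
  rw [eq_div_iff (by rw [mult_sub_inv]; simp [-Complex.ofReal_sin, hs']), mult_sub_inv,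
    mult_inv_eq, mult_eq]
  apply Complex.ext <;> simp [toC, -Complex.ofReal_cos, -Complex.ofReal_sin]
  ring

lemma fcan_sub_isBigO (a : ℝ) :
    (fun p : ℝ => fcan a A B p - a * p - -((1 + a) * B) * p ^ 2
      - ((1 + a) * B ^ 2 - a * A) * p ^ 3) =O[𝓝 0] fun p => p ^ 4 := by
  have hc : ContinuousAt (fun p : ℝ => 1 + B * p + A * p ^ 2) 0 := by fun_prop
  have hne : ∀ᶠ p : ℝ in 𝓝 0, 1 + B * p + A * p ^ 2 ≠ 0 :=
    hc.eventually_ne (by simp)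
  set g : ℝ → ℝ := fun p => -(-((1 + a) * B) * A + ((1 + a) * B ^ 2 - a * A) * B
    + ((1 + a) * B ^ 2 - a * A) * A * p) / (1 + B * p + A * p ^ 2) with hg
  have hgO : g =O[𝓝 0] fun _ => (1 : ℝ) := by
    have : ContinuousAt g 0 := ContinuousAt.div (by fun_prop) hc (by simp)
    exact this.isBigO_one ℝ
  have := (isBigO_refl (fun p : ℝ => p ^ 4) (𝓝 0)).mul hgO
  simp only [mul_one] at this
  refine this.congr' ?_ EventuallyEq.rfl
  filter_upwards [hne] with p hp
  have key : p * (a - B * p) = (a * p + -((1 + a) * B) * p ^ 2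
      + ((1 + a) * B ^ 2 - a * A) * p ^ 3) * (1 + B * p + A * p ^ 2)
      + p ^ 4 * -(-((1 + a) * B) * A + ((1 + a) * B ^ 2 - a * A) * B
      + ((1 + a) * B ^ 2 - a * A) * A * p) := by ring
  rw [hg, fcan, key, add_div, mul_div_cancel_right₀ _ hp]
  ring

lemma toC_tendsto_zero : Tendsto (fun z => ‖toC θ z‖) (𝓝 0) (𝓝 0) := by
  have : toC θ 0 = 0 := by apply Complex.ext <;> simp [toC]
  simpa [this] using ((continuous_toC θ).norm.tendsto 0)

lemma kick_isBigO (hs : 0 < sin θ) :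
    (fun z : ℝ × ℝ => (((fcan (2 * cos θ) A B z.2 - 2 * cos θ * z.2 : ℝ) : ℂ)
      - -((1 + 2 * cos θ) * B : ℝ) * (z.2 : ℂ) ^ 2
      - ((1 + 2 * cos θ) * B ^ 2 - 2 * cos θ * A : ℝ) * (z.2 : ℂ) ^ 3))
      =O[𝓝 0] fun z => ‖toC θ z‖ ^ 4 := by
  have h := (fcan_sub_isBigO A B (2 * cos θ)).comp_tendsto
    (continuous_snd.tendsto (0 : ℝ × ℝ))
  have h2 : (fun z : ℝ × ℝ => z.2) =O[𝓝 0] fun z => ‖toC θ z‖ :=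
    IsBigO.of_bound (sin θ)⁻¹ (Eventually.of_forall fun z => by
      simpa using abs_snd_le θ hs z)
  refine IsBigO.trans (IsBigO.of_norm_left ?_) (h2.pow 4)
  refine (h.norm_left).congr' (Eventually.of_forall fun z => ?_) EventuallyEq.rfl
  simp only [Function.comp]
  rw [← Complex.norm_real]
  push_cast
  rfl

/-- The image has coordinates `l w + d` and `l⁻¹ v + d` with `d = f2 p² + f3 p³ + O(4)`. After
expansion, degrees two and three vanish by the two homological equations; what is left is a sum of
explicit terms of order four. -/
theorem nf_stdMap_isBigO (hs : 0 < sin θ) :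
    (fun z => nf θ A B (stdMap (fcan (2 * cos θ) A B) z) -
      mult θ * nf θ A B z * (1 + twist θ A B * Complex.I * K0 (2 * cos θ) z))
      =O[𝓝 0] fun z => ‖toC θ z‖ ^ 4 := by
  set l := mult θ with hl
  set D := l - l⁻¹ with hD
  have h0 : l ≠ 0 := mult_ne_zero
  have h1 : l - 1 ≠ 0 := mult_sub_one_ne hs
  have h2 : l + 1 ≠ 0 := mult_add_one_ne hs
  set f2 : ℂ := -(l ^ 2 + l + 1) * B / l with hf2
  set f3 : ℂ := (l ^ 2 + l + 1) / l * B ^ 2 - (l + l⁻¹) * A with hf3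
  set E : ℂ := -2 * (l ^ 2 + l + 1) * B ^ 2 * (l + 1) / (l * D ^ 4 * (l - 1)) with hE
  have hDe : D = (l - 1) * (l + 1) / l := by rw [hD]; field_simp; ring
  set κ : ℂ := (E * (l - 2 * (l ^ 2 + l + 1)) - 3 * l * f3 / D ^ 3) / l with hκ
  have hκ' : κ = twist θ A B * Complex.I := by
    have hs' : (sin θ : ℂ) ≠ 0 := by exact_mod_cast hs.ne'
    rw [hκ, normalForm_twist h0 h1 h2 hDe hf3 hE, hD, hl, mult_add_inv, mult_sub_inv, twist]
    push_cast
    rw [← Complex.ofReal_sin, ← Complex.ofReal_cos, div_eq_iff (by simp [-Complex.ofReal_sin, hs'])]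
    field_simp
    rw [Complex.I_sq]
    ring
  -- the kick
  set d : ℝ × ℝ → ℂ := fun z => ((fcan (2 * cos θ) A B z.2 - 2 * cos θ * z.2 : ℝ) : ℂ) with hd
  set w : ℝ × ℝ → ℂ := fun z => toC θ z with hw
  set v : ℝ × ℝ → ℂ := fun z => conj (toC θ z) with hv
  set p : ℝ × ℝ → ℂ := fun z => (l * w z - l⁻¹ * v z) / D with hp
  have hpz : ∀ z, p z = z.2 := fun z => (snd_eq_toC hs z).symm
  have hl2 : (l ^ 2 + l + 1) / l = ((1 + 2 * cos θ : ℝ) : ℂ) := by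
    rw [Complex.ofReal_add, ← mult_add_inv, ← hl]; push_cast; field_simp; ring
  have hf2' : f2 = -((1 + 2 * cos θ) * B : ℝ) := by
    rw [Complex.ofReal_mul, ← hl2, hf2]; ring
  have hf3' : f3 = (((1 + 2 * cos θ) * B ^ 2 - 2 * cos θ * A : ℝ) : ℂ) := by
    rw [hf3, hl2, hl, mult_add_inv]; push_cast; ring
  set g : ℝ × ℝ → ℝ := fun z => ‖toC θ z‖ with hg
  have hg0 : Tendsto g (𝓝 0) (𝓝 0) := toC_tendsto_zero
  have hwO : w =O[𝓝 0] fun z => g z ^ 1 := IsBigO.of_bound 1 (by simp [hw, hg])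
  have hvO : v =O[𝓝 0] fun z => g z ^ 1 := IsBigO.of_bound 1 (by simp [hv, hg])
  have hpO : p =O[𝓝 0] fun z => g z ^ 1 := by
    have := ((hwO.const_mul_left l).sub (hvO.const_mul_left l⁻¹)).const_mul_left D⁻¹
    simpa only [hp, div_eq_inv_mul] using this
  have hd4 : (fun z => d z - f2 * p z ^ 2 - f3 * p z ^ 3) =O[𝓝 0] fun z => g z ^ 4 := by
    simp only [hpz, hf2', hf3']
    exact kick_isBigO A B hs
  have hp2 : (fun z => p z ^ 2) =O[𝓝 0] fun z => g z ^ 2 := by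
    exact (isBigO_pow_mul hpO hpO (rfl : 1 + 1 = 2)).congr_left fun z => (sq _).symm
  have hp3 : (fun z => p z ^ 3) =O[𝓝 0] fun z => g z ^ 3 := by
    exact (isBigO_pow_mul hp2 hpO (rfl : 2 + 1 = 3)).congr_left fun z => (pow_succ _ 2).symm
  have hd3 : (fun z => d z - f2 * p z ^ 2) =O[𝓝 0] fun z => g z ^ 3 := by
    refine ((isBigO_pow_mono hg0 hd4 (by norm_num : 3 ≤ 4)).add (hp3.const_mul_left f3)).congr_left
      fun z => ?_
    ring
  have hd2 : d =O[𝓝 0] fun z => g z ^ 2 := by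
    refine ((isBigO_pow_mono hg0 hd3 (by norm_num : 2 ≤ 3)).add (hp2.const_mul_left f2)).congr_left
      fun z => ?_
    ring
  have hdd : (fun z => d z * d z) =O[𝓝 0] fun z => g z ^ 4 := isBigO_pow_mul hd2 hd2 rfl
  -- the image point
  set w' : ℝ × ℝ → ℂ := fun z => l * w z + d z with hw'
  set v' : ℝ × ℝ → ℂ := fun z => l⁻¹ * v z + d z with hv'
  have hmw : ∀ z, toC θ (stdMap (fcan (2 * cos θ) A B) z) = w' z := fun z => toC_stdMap _ z
  have hmv : ∀ z, conj (toC θ (stdMap (fcan (2 * cos θ) A B) z)) = v' z := fun z => by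
    rw [toC_stdMap, map_add, map_mul, conj_mult, Complex.conj_ofReal]
  have hd1 := isBigO_pow_mono hg0 hd2 (by norm_num : 1 ≤ 2)
  have hw'O : w' =O[𝓝 0] fun z => g z ^ 1 := (hwO.const_mul_left l).add hd1
  have hv'O : v' =O[𝓝 0] fun z => g z ^ 1 := (hvO.const_mul_left l⁻¹).add hd1
  have hwd := isBigO_pow_mul hwO hd3 (rfl : 1 + 3 = 4)
  have hvd := isBigO_pow_mul hvO hd3 (rfl : 1 + 3 = 4)
  set a20 : ℂ := (l ^ 2 + l + 1) * B / (D ^ 2 * (l - 1)) with ha20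
  set a11 : ℂ := 2 * (l ^ 2 + l + 1) * B / (l * D ^ 2 * (l - 1)) with ha11
  set a02 : ℂ := -B / (l * D ^ 2 * (l - 1)) with ha02
  set b30 : ℂ := -(E * (l ^ 2 + l + 1) + f3 * l / D ^ 3) / D with hb30
  set b12 : ℂ := (E * (-2 * l⁻¹ + l⁻¹ ^ 2 * (l ^ 2 + l + 1)) + 3 * l⁻¹ * f3 / D ^ 3) / D with hb12
  set b03 : ℂ := -((l ^ 2 + l + 1) * B ^ 2 / (l - 1) ^ 2 - A) / (D ^ 4 * l ^ 2) with hb03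
  have hnf : ∀ z, nf θ A B z = w z + (a20 * w z ^ 2 + a11 * (w z * v z) + a02 * v z ^ 2) +
      (b30 * w z ^ 3 + b12 * (w z * v z ^ 2) + b03 * v z ^ 3) := fun z => rfl
  have hnf' : ∀ z, nf θ A B (stdMap (fcan (2 * cos θ) A B) z) =
      w' z + (a20 * w' z ^ 2 + a11 * (w' z * v' z) + a02 * v' z ^ 2) +
      (b30 * w' z ^ 3 + b12 * (w' z * v' z ^ 2) + b03 * v' z ^ 3) := fun z => by
    rw [← hmw, ← hmv]; rfl
  have hK : ∀ z, ((K0 (2 * cos θ) z : ℝ) : ℂ) = w z * v z := fun z => by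
    rw [← norm_toC_sq, Complex.mul_conj, Complex.normSq_eq_norm_sq]
  -- In the quadratic part only the cross terms with `f2 p²` have degree three; replacing `d` by `d
  -- - f2 p²` there leaves order four.
  have hquad : (fun z => 2 * a20 * l * (w z * (d z - f2 * p z ^ 2)) + a20 * (d z * d z)
      + a11 * (l * (w z * (d z - f2 * p z ^ 2)) + l⁻¹ * (v z * (d z - f2 * p z ^ 2)) + d z * d z)
      + (2 * a02 * l⁻¹ * (v z * (d z - f2 * p z ^ 2)) + a02 * (d z * d z)))
      =O[𝓝 0] fun z => g z ^ 4 :=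
    (((hwd.const_mul_left _).add (hdd.const_mul_left _)).add
      ((((hwd.const_mul_left _).add (hvd.const_mul_left _)).add hdd).const_mul_left _)).add
      ((hvd.const_mul_left _).add (hdd.const_mul_left _))
  have hww' := isBigO_pow_mul hw'O hw'O (rfl : 1 + 1 = 2)
  have hww := isBigO_pow_mul hwO hwO (rfl : 1 + 1 = 2)
  have hwv := isBigO_pow_mul hwO hvO (rfl : 1 + 1 = 2)
  have hvv := isBigO_pow_mul hvO hvO (rfl : 1 + 1 = 2)
  have hvv' := isBigO_pow_mul hv'O hv'O (rfl : 1 + 1 = 2)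
  have hmix := isBigO_pow_mul hw'O hwO (rfl : 1 + 1 = 2)
  have hmiv := isBigO_pow_mul hv'O hvO (rfl : 1 + 1 = 2)
  have hmwv := isBigO_pow_mul hwO hv'O (rfl : 1 + 1 = 2)
  -- In the cubic part every occurrence of the kick already costs order four, by the factorizations
  -- of differences of cubes.
  have hcub : (fun z => b30 * (d z * (w' z * w' z + l * (w' z * w z) + l ^ 2 * (w z * w z)))
      + b12 * (d z * (v' z * v' z + l * (w z * v' z) + (w z * v z)))
      + b03 * (d z * (v' z * v' z + l⁻¹ * (v' z * v z) + l⁻¹ ^ 2 * (v z * v z))))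
      =O[𝓝 0] fun z => g z ^ 4 :=
    (((isBigO_pow_mul hd2 ((hww'.add (hmix.const_mul_left _)).add (hww.const_mul_left _))
      rfl).const_mul_left _).add
    ((isBigO_pow_mul hd2 ((hvv'.add (hmwv.const_mul_left _)).add hwv) rfl).const_mul_left _)).add
    ((isBigO_pow_mul hd2 ((hvv'.add (hmiv.const_mul_left _)).add (hvv.const_mul_left _))
      rfl).const_mul_left _)
  have hwO2 := isBigO_pow_mono hg0 hwO (Nat.zero_le 1)
  have hvO2 := isBigO_pow_mono hg0 hvO (Nat.zero_le 1)
  have htail : (fun z => (w z * v z) * ((a20 * (w z * w z) + a11 * (w z * v z) + a02 * (v z * v z)) +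
      (b30 * (w z * (w z * w z)) + b12 * (w z * (v z * v z)) + b03 * (v z * (v z * v z)))))
      =O[𝓝 0] fun z => g z ^ 4 :=
    isBigO_pow_mul hwv ((((hww.const_mul_left _).add (hwv.const_mul_left _)).add
      (hvv.const_mul_left _)).add
      ((((isBigO_pow_mul hwO2 hww rfl).const_mul_left _).add
        ((isBigO_pow_mul hwO2 hvv rfl).const_mul_left _)).add
        ((isBigO_pow_mul hvO2 hvv rfl).const_mul_left _))) rfl
  refine (((hd4.add hquad).add hcub).add (htail.const_mul_left (-(l * κ)))).congr_left fun z => ?_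
  have e2 := normalForm_order_two (w := w z) (v := v z) (B := B) h0 h1 h2
  have e3 := normalForm_order_three (w := w z) (v := v z) h0 h1 h2 hDe hf3 hE
  rw [← hD, ← hf2, ← ha20, ← ha11, ← ha02] at e2
  rw [← hf2, ← ha20, ← ha11, ← ha02, ← hb30, ← hb12, ← hb03, ← hκ] at e3
  rw [hnf', hnf, hK, ← hκ', hw', hv']
  have hll : l * l⁻¹ = 1 := mul_inv_cancel₀ h0
  simp only [hp]
  -- The last term replaces `l * l⁻¹` by `1` in the expansion of `w' * v'²`.
  linear_combination -e2 - e3 - b12 * d z * w z * v z * hll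

end NormalForm

end McMillan

namespace McMillan

open Asymptotics Filter Topology ComplexConjugate

/-! ### Geometry of the level sets near the fixed point -/

section Geometry

/-- `R` is so small that on `‖toC θ z‖ ≤ R` the terms of higher order are dominated by the
leading ones. -/
structure GoodRadius (θ A B R : ℝ) : Prop where
  sin_pos : 0 < sin θ
  pos : 0 < R
  higher : ∀ z, ‖toC θ z‖ ≤ R →
    |B * (z.2 ^ 2 * z.1 + z.2 * z.1 ^ 2)| + |A * (z.2 ^ 2 * z.1 ^ 2)| ≤ ‖toC θ z‖ ^ 2 / 8
  denom : ∀ z : ℝ × ℝ, ‖toC θ z‖ ≤ R → 1 + B * z.2 + A * z.2 ^ 2 ≠ 0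
  step : ∀ z, ‖toC θ z‖ ≤ R →
    ‖toC θ (stdMap (fcan (2 * cos θ) A B) z) - mult θ * toC θ z‖ ≤ ‖toC θ z‖ / 4
  normal : ∀ z, ‖toC θ z‖ ≤ R → ‖nf θ A B z - toC θ z‖ ≤ ‖toC θ z‖ / 4

/-- Both coordinates are at most `(sin θ)⁻¹ ‖toC θ z‖`, so the elliptic disks shrink to the origin.
-/
lemma eventually_radius {θ : ℝ} (hs : 0 < sin θ) {P : ℝ × ℝ → Prop} (h : ∀ᶠ z in 𝓝 0, P z) :
    ∀ᶠ R in 𝓝[>] (0 : ℝ), ∀ z, ‖toC θ z‖ ≤ R → P z := by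
  obtain ⟨ε, hε, hb⟩ := Metric.eventually_nhds_iff.1 h
  have : ∀ᶠ R in 𝓝[>] (0 : ℝ), R < ε * sin θ :=
    (eventually_lt_nhds (by positivity)).filter_mono nhdsWithin_le_nhds
  filter_upwards [this] with R hR z hz
  apply hb
  have key : (sin θ)⁻¹ * ‖toC θ z‖ < ε := by
    rw [inv_mul_eq_div, div_lt_iff₀ hs]
    exact hz.trans_lt hR
  rw [dist_zero_right, Prod.norm_def, max_lt_iff]
  exact ⟨(abs_fst_le θ hs z).trans_lt key, (abs_snd_le θ hs z).trans_lt key⟩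

lemma isBigO_fst {θ : ℝ} (hs : 0 < sin θ) :
    (fun z : ℝ × ℝ => z.1) =O[𝓝 0] fun z => ‖toC θ z‖ :=
  IsBigO.of_bound (sin θ)⁻¹ (Eventually.of_forall fun z => by simpa using abs_fst_le θ hs z)

lemma isBigO_snd {θ : ℝ} (hs : 0 < sin θ) :
    (fun z : ℝ × ℝ => z.2) =O[𝓝 0] fun z => ‖toC θ z‖ :=
  IsBigO.of_bound (sin θ)⁻¹ (Eventually.of_forall fun z => by simpa using abs_snd_le θ hs z)

lemma eventually_le_of_isBigO {θ : ℝ} {E : Type*} [SeminormedAddCommGroup E] {f : ℝ × ℝ → E} {m : ℕ}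
    (h : f =O[𝓝 0] fun z => ‖toC θ z‖ ^ (m + 1)) {c : ℝ} (hc : 0 < c) :
    ∀ᶠ z in 𝓝 0, ‖f z‖ ≤ c * ‖toC θ z‖ ^ m := by
  obtain ⟨C, hC, hb⟩ := h.exists_pos
  have h0 : ∀ᶠ z in 𝓝 (0 : ℝ × ℝ), ‖toC θ z‖ < c / C :=
    (toC_tendsto_zero (θ := θ)).eventually_lt_const (by positivity)
  filter_upwards [hb.bound, h0] with z h1 h2
  refine h1.trans ?_
  rw [norm_pow, norm_norm, pow_succ, mul_comm (_ ^ m), ← mul_assoc]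
  rw [lt_div_iff₀' hC] at h2
  gcongr

lemma cubic_isBigO {θ : ℝ} (B : ℝ) (hs : 0 < sin θ) :
    (fun z : ℝ × ℝ => B * (z.2 ^ 2 * z.1 + z.2 * z.1 ^ 2)) =O[𝓝 0] fun z => ‖toC θ z‖ ^ 3 := by
  refine IsBigO.const_mul_left ?_ B
  refine IsBigO.add ?_ ?_
  · refine (((isBigO_snd hs).pow 2).mul (isBigO_fst hs)).congr_right fun z => by ring
  · refine ((isBigO_snd hs).mul ((isBigO_fst hs).pow 2)).congr_right fun z => by ring

lemma quartic_isBigO {θ : ℝ} (A : ℝ) (hs : 0 < sin θ) :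
    (fun z : ℝ × ℝ => A * (z.2 ^ 2 * z.1 ^ 2)) =O[𝓝 0] fun z => ‖toC θ z‖ ^ 4 := by
  refine IsBigO.const_mul_left ?_ A
  refine (((isBigO_snd hs).pow 2).mul ((isBigO_fst hs).pow 2)).congr_right fun z => by ring

lemma isBigO_toC_pow {θ : ℝ} {f : ℝ × ℝ → ℝ} {m k : ℕ} (h : f =O[𝓝 0] fun z => ‖toC θ z‖ ^ m)
    (hk : k ≤ m) : f =O[𝓝 0] fun z => ‖toC θ z‖ ^ k := by
  obtain ⟨j, rfl⟩ := Nat.exists_eq_add_of_le hk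
  refine h.trans ?_
  have h1 : (fun z => ‖toC θ z‖ ^ j) =O[𝓝 0] fun _ => (1 : ℝ) :=
    ((toC_tendsto_zero (θ := θ)).pow j).isBigO_one ℝ
  simpa only [pow_add, mul_one] using (isBigO_refl (fun z => ‖toC θ z‖ ^ k) _).mul h1

lemma Kcan_sub_isBigO {θ : ℝ} (A B : ℝ) (hs : 0 < sin θ) :
    (fun z => Kcan (2 * cos θ) A B z - ‖toC θ z‖ ^ 2) =O[𝓝 0] fun z => ‖toC θ z‖ ^ 3 := by
  refine ((cubic_isBigO B hs).add (isBigO_toC_pow (quartic_isBigO A hs) (by norm_num))).congr_left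
    fun z => ?_
  rw [norm_toC_sq, Kcan]
  ring

lemma step_isBigO {θ : ℝ} (A B : ℝ) (hs : 0 < sin θ) :
    (fun z => toC θ (stdMap (fcan (2 * cos θ) A B) z) - mult θ * toC θ z)
      =O[𝓝 0] fun z => ‖toC θ z‖ ^ 2 := by
  have h := isBigO_pow_mono (toC_tendsto_zero (θ := θ)) (kick_isBigO A B hs)
    (by norm_num : 2 ≤ 4)
  have hp : (fun z : ℝ × ℝ => (z.2 : ℂ)) =O[𝓝 0] fun z => ‖toC θ z‖ :=
    ((isBigO_snd hs).norm_left.congr_left fun z => (Complex.norm_real z.2).symm).of_norm_left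
  have h3 := isBigO_pow_mono (toC_tendsto_zero (θ := θ)) (hp.pow 3) (by norm_num : 2 ≤ 3)
  refine ((h.add ((hp.pow 2).const_mul_left (-(((1 + 2 * cos θ) * B : ℝ) : ℂ)))).add
    (h3.const_mul_left (((1 + 2 * cos θ) * B ^ 2 - 2 * cos θ * A : ℝ) : ℂ))).congr_left fun z => ?_
  rw [toC_stdMap]
  ring

lemma nf_sub_isBigO (θ A B : ℝ) :
    (fun z => nf θ A B z - toC θ z) =O[𝓝 0] fun z => ‖toC θ z‖ ^ 2 := by
  have hg := toC_tendsto_zero (θ := θ)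
  have hw : (fun z => toC θ z) =O[𝓝 0] fun z => ‖toC θ z‖ := (isBigO_refl _ _).norm_right
  have hv : (fun z => conj (toC θ z)) =O[𝓝 0] fun z => ‖toC θ z‖ :=
    IsBigO.of_bound 1 (by simp)
  have h2 : (fun z => nfQuad θ B (toC θ z) (conj (toC θ z))) =O[𝓝 0] fun z => ‖toC θ z‖ ^ 2 :=
    (((hw.pow 2).const_mul_left _).add
      (((hw.mul hv).congr_right fun z => (sq _).symm).const_mul_left _)).add
      ((hv.pow 2).const_mul_left _)
  have h3 : (fun z => nfCubic θ A B (toC θ z) (conj (toC θ z))) =O[𝓝 0] fun z => ‖toC θ z‖ ^ 3 :=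
    (((hw.pow 3).const_mul_left _).add
      (((hw.mul (hv.pow 2)).congr_right fun z => (pow_succ' _ 2).symm).const_mul_left _)).add
      ((hv.pow 3).const_mul_left _)
  refine (h2.add (isBigO_pow_mono hg h3 (by norm_num))).congr_left fun z => ?_
  rw [nf]
  ring

lemma eventually_goodRadius {θ : ℝ} (A B : ℝ) (hs : 0 < sin θ) :
    ∀ᶠ R in 𝓝[>] (0 : ℝ), GoodRadius θ A B R := by
  have h3 := eventually_le_of_isBigO (cubic_isBigO B hs) (c := 1 / 16) (by norm_num)
  have h4 := eventually_le_of_isBigO (isBigO_toC_pow (quartic_isBigO A hs)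
    (by norm_num : 3 ≤ 4)) (c := 1 / 16) (by norm_num)
  have hd : ∀ᶠ z : ℝ × ℝ in 𝓝 0, 1 + B * z.2 + A * z.2 ^ 2 ≠ 0 := by
    have : ContinuousAt (fun z : ℝ × ℝ => 1 + B * z.2 + A * z.2 ^ 2) 0 := by fun_prop
    exact this.eventually_ne (by simp)
  have hst := eventually_le_of_isBigO (m := 1) (step_isBigO A B hs) (c := 1 / 4) (by norm_num)
  have hn := eventually_le_of_isBigO (m := 1) (nf_sub_isBigO θ A B) (c := 1 / 4) (by norm_num)
  filter_upwards [eventually_radius hs h3, eventually_radius hs h4, eventually_radius hs hd,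
    eventually_radius hs hst, eventually_radius hs hn, self_mem_nhdsWithin] with R e3 e4 ed es en e0
  refine ⟨hs, e0, fun z hz => ?_, ed, fun z hz => (es z hz).trans_eq (by ring),
    fun z hz => (en z hz).trans_eq (by ring)⟩
  have := e3 z hz
  have := e4 z hz
  simp only [Real.norm_eq_abs] at *
  linarith

end Geometry

end McMillan

namespace McMillan

open Asymptotics Filter Topology ComplexConjugate Pointwise

/-! ### ### Star-shaped wells: the region and its boundary -/

section Wells

/-- The part near the fixed point of the sublevel set of height `h`. -/
def well (θ A B R h : ℝ) : Set (ℝ × ℝ) := {z | Kcan (2 * cos θ) A B z < h ∧ ‖toC θ z‖ < R}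

variable {θ A B R h t : ℝ} {z : ℝ × ℝ}

@[fun_prop]
lemma continuous_Kcan (a A B : ℝ) : Continuous (Kcan a A B) := by
  unfold Kcan K0; fun_prop

lemma Kcan_zero (a A B : ℝ) : Kcan a A B 0 = 0 := by simp [Kcan, K0]

lemma toC_zero (θ : ℝ) : toC θ 0 = 0 := by apply Complex.ext <;> simp [toC]

lemma norm_toC_smul (ht : 0 ≤ t) : ‖toC θ (t • z)‖ = t * ‖toC θ z‖ := by
  rw [toC_smul, norm_mul, Complex.norm_real, Real.norm_of_nonneg ht]

lemma isOpen_well : IsOpen (well θ A B R h) :=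
  IsOpen.and (isOpen_lt (continuous_Kcan _ _ _) continuous_const)
    (isOpen_lt (continuous_toC θ).norm continuous_const)

namespace GoodRadius

variable (hR : GoodRadius θ A B R)
include hR

lemma Kcan_lower (hz : ‖toC θ z‖ ≤ R) : 7 / 8 * ‖toC θ z‖ ^ 2 ≤ Kcan (2 * cos θ) A B z := by
  have h1 := hR.higher z hz
  have h2 := neg_abs_le (B * (z.2 ^ 2 * z.1 + z.2 * z.1 ^ 2))
  have h3 := neg_abs_le (A * (z.2 ^ 2 * z.1 ^ 2))
  rw [Kcan, ← norm_toC_sq]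
  linarith

/-- The difference is `t (1 - t)` times the leading part plus at most `2|c3| + 3|c4|`, and the `1 /
8` in `higher` makes the latter at most three eighths of `K0`. This gives star-shapedness,
monotonicity along rays and the inclusion of `t • D_h` in `D_(t h)`. -/
lemma Kcan_smul_le (hz : ‖toC θ z‖ ≤ R) (h0 : 0 ≤ t) (h1 : t ≤ 1) :
    Kcan (2 * cos θ) A B (t • z) ≤ t * Kcan (2 * cos θ) A B z := by
  have e1 := hR.higher z hz
  rw [norm_toC_sq] at e1
  set c3 := B * (z.2 ^ 2 * z.1 + z.2 * z.1 ^ 2) with hc3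
  set c4 := A * (z.2 ^ 2 * z.1 ^ 2) with hc4
  have hK : 0 ≤ K0 (2 * cos θ) z := by rw [← norm_toC_sq]; positivity
  have key : t * Kcan (2 * cos θ) A B z - Kcan (2 * cos θ) A B (t • z) =
      t * (1 - t) * (K0 (2 * cos θ) z + (1 + t) * c3 + (1 + t + t ^ 2) * c4) := by
    simp only [Kcan, K0, Prod.smul_fst, Prod.smul_snd, smul_eq_mul, hc3, hc4]
    ring
  have e3 : -(2 * |c3|) ≤ (1 + t) * c3 := by
    have := neg_abs_le ((1 + t) * c3)
    rw [abs_mul, abs_of_nonneg (by linarith : (0 : ℝ) ≤ 1 + t)] at this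
    nlinarith [abs_nonneg c3]
  have e4 : -(3 * |c4|) ≤ (1 + t + t ^ 2) * c4 := by
    have := neg_abs_le ((1 + t + t ^ 2) * c4)
    rw [abs_mul, abs_of_nonneg (by positivity : (0 : ℝ) ≤ 1 + t + t ^ 2)] at this
    have h3 : 1 + t + t ^ 2 ≤ 3 := by nlinarith
    nlinarith [mul_le_mul_of_nonneg_right h3 (abs_nonneg c4)]
  have : 0 ≤ t * (1 - t) * (K0 (2 * cos θ) z + (1 + t) * c3 + (1 + t + t ^ 2) * c4) := by
    apply mul_nonneg (mul_nonneg h0 (by linarith))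
    linarith [abs_nonneg c3]
  linarith

/-- With the weight `t ^ 3` the cubic terms cancel, and only the quartic one must be dominated. This
is the inequality behind strict growth of the action. -/
lemma le_Kcan_smul (hz : ‖toC θ z‖ ≤ R) (h0 : 0 ≤ t) (h1 : t ≤ 1) :
    t ^ 3 * Kcan (2 * cos θ) A B z ≤ Kcan (2 * cos θ) A B (t • z) := by
  have e1 := hR.higher z hz
  rw [norm_toC_sq] at e1
  set c3 := B * (z.2 ^ 2 * z.1 + z.2 * z.1 ^ 2) with hc3
  set c4 := A * (z.2 ^ 2 * z.1 ^ 2) with hc4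
  have key : Kcan (2 * cos θ) A B (t • z) - t ^ 3 * Kcan (2 * cos θ) A B z =
      t ^ 2 * (1 - t) * (K0 (2 * cos θ) z - t * c4) := by
    simp only [Kcan, K0, Prod.smul_fst, Prod.smul_snd, smul_eq_mul, hc4]
    ring
  have e4 : t * c4 ≤ |c4| := by
    have := le_abs_self (t * c4)
    rw [abs_mul, abs_of_nonneg h0] at this
    nlinarith [abs_nonneg c4]
  have : 0 ≤ t ^ 2 * (1 - t) * (K0 (2 * cos θ) z - t * c4) := by
    apply mul_nonneg (mul_nonneg (sq_nonneg _) (by linarith))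
    have hK : 0 ≤ K0 (2 * cos θ) z := by rw [← norm_toC_sq]; positivity
    linarith [abs_nonneg c3]
  linarith

/-- The circle of radius `R` is a barrier: there `K ≥ 7/8 R² > R²/2`. -/
lemma norm_ne_of_lt (hh : h < R ^ 2 / 2) (hz : Kcan (2 * cos θ) A B z ≤ h) : ‖toC θ z‖ ≠ R := by
  intro h1
  have := hR.Kcan_lower h1.le
  rw [h1] at this
  nlinarith [hR.pos]

lemma sq_lt_of_le (hz : ‖toC θ z‖ ≤ R) (hK : Kcan (2 * cos θ) A B z ≤ h) :
    ‖toC θ z‖ ^ 2 ≤ 8 / 7 * h := by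
  have := hR.Kcan_lower hz
  linarith

lemma smul_mem_well {r : ℝ} (h0 : 0 ≤ t) (h1 : t ≤ 1) (hz : z ∈ well θ A B R r) (ht : t * r ≤ h)
    (hpos : 0 < h) : t • z ∈ well θ A B R h := by
  constructor
  · rcases h0.eq_or_lt with rfl | h0
    · simpa [Kcan_zero] using hpos
    · exact (hR.Kcan_smul_le hz.2.le h0.le h1).trans_lt
        ((mul_lt_mul_of_pos_left hz.1 h0).trans_le ht)
  · rw [norm_toC_smul h0]
    nlinarith [norm_nonneg (toC θ z), hz.2]

lemma zero_mem_well (hh : 0 < h) : (0 : ℝ × ℝ) ∈ well θ A B R h := by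
  refine And.intro ((Kcan_zero _ _ _).trans_lt hh) ?_
  rw [toC_zero, norm_zero]
  exact hR.pos

lemma isPreconnected_well (hh : 0 < h) : IsPreconnected (well θ A B R h) := by
  have : StarConvex ℝ 0 (well θ A B R h) := starConvex_zero_iff.2 fun z hz t h0 h1 =>
    hR.smul_mem_well h0 h1 hz (mul_le_of_le_one_left hh.le h1) hh
  exact (this.isPathConnected (hR.zero_mem_well hh)).isConnected.isPreconnected

/-- The component of `0` cannot cross the barrier circle, and conversely the well is star-shaped,
hence connected. -/
theorem region_eq (hh : 0 < h) (hh' : h < R ^ 2 / 2) :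
    region (Kcan (2 * cos θ) A B) 0 h = well θ A B R h := by
  rw [region, Kcan_zero, zero_add]
  apply Subset.antisymm
  · have hsub := connectedComponentIn_subset {z | Kcan (2 * cos θ) A B z < h} 0
    have h0 : (0 : ℝ × ℝ) ∈ {z | Kcan (2 * cos θ) A B z < h} := by
      simpa [Kcan_zero] using hh
    have := isPreconnected_connectedComponentIn.subset_left_of_subset_union
      (s := connectedComponentIn {z | Kcan (2 * cos θ) A B z < h} 0)
      (isOpen_lt (continuous_toC θ).norm (continuous_const (y := R)))
      (isOpen_lt (continuous_const (y := R)) (continuous_toC θ).norm)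
      (disjoint_left.2 fun z (h1 : _ < R) (h2 : R < _) => lt_asymm h1 h2)
      (fun z hz => (hR.norm_ne_of_lt hh' (hsub hz).le).lt_or_gt)
      ⟨0, mem_connectedComponentIn h0, (hR.zero_mem_well hh).2⟩
    exact fun z hz => ⟨hsub hz, this hz⟩
  · exact (hR.isPreconnected_well hh).subset_connectedComponentIn (hR.zero_mem_well hh)
      fun z hz => hz.1

theorem curve_eq (hh : 0 < h) (hh' : h < R ^ 2 / 2) :
    curve (Kcan (2 * cos θ) A B) 0 h = {z | Kcan (2 * cos θ) A B z = h ∧ ‖toC θ z‖ < R} := by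
  rw [curve, hR.region_eq hh hh', isOpen_well.frontier_eq]
  ext z
  constructor
  · rintro ⟨hc, hn⟩
    have h1 : Kcan (2 * cos θ) A B z ≤ h := closure_minimal (fun z hz => hz.1.le)
      (isClosed_le (continuous_Kcan _ _ _) continuous_const) hc
    have h2 : ‖toC θ z‖ ≤ R := closure_minimal (s := well θ A B R h) (fun z hz => hz.2.le)
      (isClosed_le (continuous_toC θ).norm continuous_const) hc
    have h3 : ‖toC θ z‖ < R := h2.lt_of_ne (hR.norm_ne_of_lt hh' h1)
    exact ⟨h1.eq_of_not_lt fun h4 => hn ⟨h4, h3⟩, h3⟩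
  · rintro ⟨h1, h2⟩
    refine ⟨?_, fun hn => hn.1.ne h1⟩
    -- A point on the level is approached from inside along its ray, since `K (t z) ≤ t h < h`.
    have hcont : Tendsto (fun t : ℝ => t • z) (𝓝[<] 1) (𝓝 z) := by
      have : Continuous fun t : ℝ => t • z := by fun_prop
      simpa using (this.tendsto 1).mono_left nhdsWithin_le_nhds
    refine mem_closure_of_tendsto hcont ?_
    have h01 : ∀ᶠ t in 𝓝[<] (1 : ℝ), t ∈ Ioo (0 : ℝ) 1 := Ioo_mem_nhdsLT one_pos
    filter_upwards [h01] with t ht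
    refine ⟨(hR.Kcan_smul_le h2.le ht.1.le ht.2.le).trans_lt ?_, ?_⟩
    · rw [h1]; nlinarith [ht.2]
    · rw [norm_toC_smul ht.1.le]
      nlinarith [norm_nonneg (toC θ z), ht.1, ht.2]

end GoodRadius

/-! ### The action -/

open MeasureTheory

/-- `toC θ` is linear with determinant `-sin θ`, so areas of disks are divided by `sin θ`. -/
lemma volume_ellipse (hs : 0 < sin θ) {r : ℝ} (hr : 0 ≤ r) :
    volume {z : ℝ × ℝ | ‖toC θ z‖ < r} = ENNReal.ofReal (π * r ^ 2 / sin θ) := by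
  let L : (ℝ × ℝ) →ₗ[ℝ] (ℝ × ℝ) :=
    Matrix.toLin (Module.Basis.finTwoProd ℝ) (Module.Basis.finTwoProd ℝ) !![-cos θ, 1; sin θ, 0]
  have hdet : LinearMap.det L = -sin θ := by
    rw [LinearMap.det_toLin, Matrix.det_fin_two_of]; ring
  have hL : ∀ z : ℝ × ℝ, Complex.measurableEquivRealProd (toC θ z) = L z := by
    intro z
    simp [L, toC, Matrix.toLin_finTwoProd_apply, Complex.measurableEquivRealProd_apply]
    ring
  have h1 : {z : ℝ × ℝ | ‖toC θ z‖ < r} =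
      L ⁻¹' (Complex.measurableEquivRealProd.symm ⁻¹' Metric.ball 0 r) := by
    ext z
    simp [← hL]
  have hm := Complex.volume_preserving_equiv_real_prod.symm
  rw [h1, Measure.addHaar_preimage_linearMap _ (by rw [hdet]; exact (neg_neg_of_pos hs).ne),
    hm.measure_preimage measurableSet_ball.nullMeasurableSet, Complex.volume_ball, hdet,
    abs_inv, abs_neg, abs_of_pos hs, ← ENNReal.ofReal_pow hr]
  rw [show (NNReal.pi : ENNReal) = ENNReal.ofReal π by
    rw [← NNReal.coe_real_pi, ENNReal.ofReal_coe_nnreal]]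
  rw [← ENNReal.ofReal_mul (by positivity), ← ENNReal.ofReal_mul (by positivity)]
  congr 1
  field_simp

lemma volume_smul_well :
    (volume (t • well θ A B R h)).toReal = t ^ 2 * (volume (well θ A B R h)).toReal := by
  rw [Measure.addHaar_smul, ENNReal.toReal_mul]
  simp [sq_nonneg]

namespace GoodRadius

variable (hR : GoodRadius θ A B R)
include hR

lemma volume_well_ne_top : volume (well θ A B R h) ≠ ⊤ := by
  refine ne_top_of_le_ne_top ?_ (measure_mono (t := {z | ‖toC θ z‖ < R}) fun z hz => hz.2)
  rw [volume_ellipse hR.sin_pos hR.pos.le]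
  exact ENNReal.ofReal_ne_top

lemma action_eq (hh : 0 < h) (hh' : h < R ^ 2 / 2) :
    action (Kcan (2 * cos θ) A B) 0 h = (volume (well θ A B R h)).toReal / (2 * π) := by
  rw [action, hR.region_eq hh hh']

lemma sq_mul_action_le (hh : 0 < h) (hh' : h < R ^ 2 / 2) (h0 : 0 < t) (h1 : t ≤ 1) :
    t ^ 2 * action (Kcan (2 * cos θ) A B) 0 h ≤ action (Kcan (2 * cos θ) A B) 0 (t * h) := by
  rw [hR.action_eq hh hh', hR.action_eq (by positivity) (by nlinarith), ← mul_div_assoc,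
    ← volume_smul_well]
  gcongr
  · exact hR.volume_well_ne_top
  · rintro _ ⟨z, hz, rfl⟩
    exact hR.smul_mem_well h0.le h1 hz le_rfl (by positivity)

/-- By `le_Kcan_smul` the well of height `t³ h` lies in `t` times the well of height `h`. -/
lemma action_le_sq_mul (hh : 0 < h) (hh' : h < R ^ 2 / 2) (h0 : 0 < t) (h1 : t ≤ 1) :
    action (Kcan (2 * cos θ) A B) 0 (t ^ 3 * h) ≤ t ^ 2 * action (Kcan (2 * cos θ) A B) 0 h := by
  have h3 : t ^ 3 ≤ 1 := pow_le_one₀ h0.le h1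
  rw [hR.action_eq hh hh', hR.action_eq (by positivity) (by nlinarith), ← mul_div_assoc,
    ← volume_smul_well]
  gcongr
  · rw [Measure.addHaar_smul]
    exact ENNReal.mul_ne_top ENNReal.ofReal_ne_top hR.volume_well_ne_top
  · intro z hz
    refine (mem_smul_set_iff_inv_smul_mem₀ h0.ne' _ _).2 ?_
    have e1 := hR.sq_lt_of_le hz.2.le hz.1.le
    -- Dividing by `t` stays inside the disk: `‖toC θ z‖² ≤ 8/7 t³ h ≤ 8/7 t² h < t² R²`.
    have e2 : ‖toC θ (t⁻¹ • z)‖ < R := by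
      rw [norm_toC_smul (by positivity)]
      apply lt_of_pow_lt_pow_left₀ 2 hR.pos.le
      rw [mul_pow, inv_pow, inv_mul_lt_iff₀ (by positivity)]
      have : t ^ 3 * h ≤ t ^ 2 * h := by
        rw [pow_succ]; nlinarith [mul_pos (pow_pos h0 2) hh]
      nlinarith [pow_pos h0 2, hR.pos]
    refine ⟨?_, e2⟩
    have e3 := hR.le_Kcan_smul e2.le h0.le h1
    rw [smul_inv_smul₀ h0.ne'] at e3
    exact lt_of_mul_lt_mul_left (e3.trans_lt hz.1) (by positivity)

lemma exists_Kcan_bound : ∃ C, 0 ≤ C ∧ ∀ᶠ h in 𝓝[>] (0 : ℝ), ∀ z, ‖toC θ z‖ ^ 2 ≤ 2 * h →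
    ‖toC θ z‖ < R ∧ |Kcan (2 * cos θ) A B z - ‖toC θ z‖ ^ 2| ≤ C * (h * √h) := by
  obtain ⟨D, hD, hb⟩ := (Kcan_sub_isBigO A B hR.sin_pos).exists_pos
  obtain ⟨R', hb', hR'⟩ :=
    ((eventually_radius hR.sin_pos hb.bound).and self_mem_nhdsWithin).exists
  have hR' : 0 < R' := hR'
  have hev : ∀ᶠ h in 𝓝[>] (0 : ℝ), h < min R R' ^ 2 / 2 :=
    (eventually_lt_nhds (by have := hR.pos; positivity)).filter_mono nhdsWithin_le_nhds
  refine ⟨D * 3, by positivity, ?_⟩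
  filter_upwards [hev, self_mem_nhdsWithin] with h hh (h0 : 0 < h) z hz
  have hlt : ‖toC θ z‖ < min R R' := by
    apply lt_of_pow_lt_pow_left₀ 2 (le_min hR.pos.le hR'.le)
    linarith
  refine ⟨hlt.trans_le (min_le_left _ _), (hb' z (hlt.trans_le (min_le_right _ _)).le).trans ?_⟩
  rw [norm_pow, norm_norm, mul_assoc]
  have h2 : ‖toC θ z‖ ≤ 3 / 2 * √h := by
    refine (sq_le_sq₀ (norm_nonneg _) (by positivity)).1 ?_
    rw [mul_pow, sq_sqrt h0.le]
    linarith
  gcongr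
  calc ‖toC θ z‖ ^ 3 = ‖toC θ z‖ ^ 2 * ‖toC θ z‖ := pow_succ _ 2
    _ ≤ 2 * h * (3 / 2 * √h) := by gcongr
    _ = 3 * (h * √h) := by ring

/-- The well lies between the ellipses of squared radius `h ± C h^(3/2)`; the one of squared radius
`r` has area `π r / sin θ`. -/
lemma exists_action_bound : ∃ C, 0 ≤ C ∧ ∀ᶠ h in 𝓝[>] (0 : ℝ),
    |2 * sin θ * action (Kcan (2 * cos θ) A B) 0 h - h| ≤ C * (h * √h) := by
  obtain ⟨C, hC, hb⟩ := hR.exists_Kcan_bound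
  have hev : ∀ᶠ h in 𝓝[>] (0 : ℝ), h < R ^ 2 / 2 :=
    (eventually_lt_nhds (by have := hR.pos; positivity)).filter_mono nhdsWithin_le_nhds
  have hev2 : ∀ᶠ h in 𝓝[>] (0 : ℝ), C * √h < 1 := by
    have : ContinuousAt (fun h => C * √h) 0 := by fun_prop
    exact (this.eventually_lt continuousAt_const (by simp)).filter_mono nhdsWithin_le_nhds
  have hs := hR.sin_pos
  refine ⟨C, hC, ?_⟩
  filter_upwards [hb, hev, hev2, self_mem_nhdsWithin] with h hb hh hh2 (h0 : 0 < h)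
  have e0 : C * (h * √h) < h := by nlinarith
  have e1 : 0 ≤ h - C * (h * √h) := by linarith
  have e2 : 0 ≤ h + C * (h * √h) := by positivity
  have hJ : 2 * sin θ * action (Kcan (2 * cos θ) A B) 0 h =
      sin θ / π * (volume (well θ A B R h)).toReal := by
    rw [hR.action_eq h0 hh]; field_simp
  have vol : ∀ r, 0 ≤ r → sin θ / π * (volume {z : ℝ × ℝ | ‖toC θ z‖ < √r}).toReal = r := by
    intro r hr
    rw [volume_ellipse hs (sqrt_nonneg r), sq_sqrt hr, ENNReal.toReal_ofReal (by positivity)]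
    field_simp
  have up : well θ A B R h ⊆ {z : ℝ × ℝ | ‖toC θ z‖ < √(h + C * (h * √h))} := by
    intro z hz
    have := (abs_le.1 (hb z ((hR.sq_lt_of_le hz.2.le hz.1.le).trans (by linarith))).2).1
    exact (lt_sqrt (norm_nonneg _)).2 (by linarith [hz.1])
  have low : {z : ℝ × ℝ | ‖toC θ z‖ < √(h - C * (h * √h))} ⊆ well θ A B R h := by
    intro z hz
    have hz' := (lt_sqrt (norm_nonneg _)).1 hz
    have := hb z (by nlinarith [mul_nonneg hC (mul_nonneg h0.le (sqrt_nonneg h))])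
    exact ⟨by linarith [(abs_le.1 this.2).2], this.1⟩
  have m1 := ENNReal.toReal_mono (by rw [volume_ellipse hs (sqrt_nonneg _)]; exact ENNReal.ofReal_ne_top)
    (measure_mono (μ := volume) up)
  have m2 := ENNReal.toReal_mono hR.volume_well_ne_top (measure_mono (μ := volume) low)
  have hc : 0 ≤ sin θ / π := by positivity
  have m1' := mul_le_mul_of_nonneg_left m1 hc
  have m2' := mul_le_mul_of_nonneg_left m2 hc
  rw [vol _ e2] at m1'
  rw [vol _ e1] at m2'
  rw [hJ, abs_le]
  constructor <;> linarith

end GoodRadius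

end Wells

end McMillan

namespace McMillan

open Asymptotics Filter Topology ComplexConjugate

/-! ### Parametrization of the invariant curves -/

section Curves

variable {θ A B R h : ℝ}

/-- The inverse of `toC`. -/
noncomputable def ofC (θ : ℝ) (w : ℂ) : ℝ × ℝ := (w.im / sin θ, w.re + cos θ * w.im / sin θ)

lemma toC_ofC (hs : 0 < sin θ) (w : ℂ) : toC θ (ofC θ w) = w := by
  have := hs.ne'
  apply Complex.ext <;> simp only [toC, ofC] <;> field_simp
  ring

lemma ofC_toC (hs : 0 < sin θ) (z : ℝ × ℝ) : ofC θ (toC θ z) = z := by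
  have := hs.ne'
  apply Prod.ext <;> simp only [toC, ofC] <;> field_simp
  ring

lemma toC_injective (hs : 0 < sin θ) : Function.Injective (toC θ) :=
  Function.LeftInverse.injective (ofC_toC hs)

@[fun_prop]
lemma continuous_ofC (θ : ℝ) : Continuous (ofC θ) := by
  unfold ofC
  have := Complex.continuous_re
  have := Complex.continuous_im
  fun_prop

/-- The point with elliptic polar coordinates `1` and `φ`. -/
noncomputable def ray (θ φ : ℝ) : ℝ × ℝ := ofC θ (Complex.exp (φ * Complex.I))

@[fun_prop]
lemma continuous_ray (θ : ℝ) : Continuous (ray θ) := by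
  unfold ray; fun_prop

lemma toC_smul_ray (hs : 0 < sin θ) (r φ : ℝ) :
    toC θ (r • ray θ φ) = r * Complex.exp (φ * Complex.I) := by
  rw [toC_smul, ray, toC_ofC hs]

lemma norm_toC_smul_ray (hs : 0 < sin θ) {r : ℝ} (hr : 0 ≤ r) (φ : ℝ) :
    ‖toC θ (r • ray θ φ)‖ = r := by
  rw [toC_smul_ray hs, norm_mul, Complex.norm_exp_ofReal_mul_I, mul_one, Complex.norm_real,
    Real.norm_of_nonneg hr]

lemma ray_add_two_pi (θ φ : ℝ) : ray θ (φ + 2 * π) = ray θ φ := by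
  rw [ray, ray, Complex.ofReal_add, add_mul, Complex.exp_add]
  push_cast
  rw [Complex.exp_two_pi_mul_I, mul_one]

/-- `Y φ` is `sin θ * (q - i p)` divided by `exp (i (φ - π/2))`, where `(q, p)` is the point of the
ray. Whenever `Y` is real its value is `sin θ` or `1`, so it avoids the slit; its principal argument
is then continuous and `2π`-periodic, and the true angle gains exactly `2π`. -/
lemma exists_winding (hs : 0 < sin θ) : ∃ c ψ : ℝ → ℝ, Continuous ψ ∧ (∀ φ, 0 < c φ) ∧
    (∀ φ, ψ (φ + 2 * π) = ψ φ + 2 * π) ∧ ∀ φ, ray θ φ = c φ • (cos (ψ φ), -sin (ψ φ)) := by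
  set Y : ℝ → ℂ := fun φ =>
    ⟨sin θ * cos φ ^ 2 + cos θ * sin φ * cos φ + sin φ ^ 2,
      sin φ * ((1 - sin θ) * cos φ - cos θ * sin φ)⟩ with hY
  have hYs : ∀ φ, Y φ ∈ Complex.slitPlane := by
    intro φ
    rw [Complex.mem_slitPlane_iff]
    by_contra! hcon
    simp only [hY] at hcon
    obtain ⟨hre, him⟩ := hcon
    have hsc := sin_sq_add_cos_sq φ
    rcases mul_eq_zero.1 him with h0 | h0
    · rw [h0] at hre hsc
      nlinarith
    · have : sin θ * cos φ ^ 2 + cos θ * sin φ * cos φ + sin φ ^ 2 = 1 := by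
        linear_combination hsc - cos φ * h0
      linarith
  have hYc : Continuous Y := by
    have : Y = fun φ => ((sin θ * cos φ ^ 2 + cos θ * sin φ * cos φ + sin φ ^ 2 : ℝ) : ℂ) +
        (sin φ * ((1 - sin θ) * cos φ - cos θ * sin φ) : ℝ) * Complex.I := by
      funext φ
      apply Complex.ext <;> simp only [hY, Complex.add_re, Complex.add_im, Complex.re_ofReal_mul,
        Complex.im_ofReal_mul, Complex.I_re, Complex.I_im, Complex.ofReal_re, Complex.ofReal_im] <;>
        ring
    rw [this]
    fun_prop
  refine ⟨fun φ => ‖Y φ‖ / sin θ, fun φ => φ - π / 2 + Complex.arg (Y φ), ?_, ?_, ?_, ?_⟩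
  · exact (continuous_id.sub continuous_const).add
      (continuous_iff_continuousAt.2 fun φ => ContinuousAt.comp (f := Y) (g := Complex.arg)
        (Complex.continuousAt_arg (hYs φ)) hYc.continuousAt)
  · intro φ
    exact div_pos (norm_pos_iff.2 (Complex.slitPlane_ne_zero (hYs φ))) hs
  · intro φ
    have : Y (φ + 2 * π) = Y φ := by simp [hY]
    simp only [this]
    ring
  · intro φ
    have e1 : ‖Y φ‖ * cos (Complex.arg (Y φ)) = (Y φ).re := Complex.norm_mul_cos_arg _
    have e2 : ‖Y φ‖ * sin (Complex.arg (Y φ)) = (Y φ).im := Complex.norm_mul_sin_arg _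
    have hsc := sin_sq_add_cos_sq φ
    have hs' := hs.ne'
    simp only [hY] at e1 e2
    rw [ray, ofC, Complex.exp_ofReal_mul_I_re, Complex.exp_ofReal_mul_I_im]
    have a1 : cos (φ - π / 2 + Complex.arg (Y φ)) =
        sin φ * cos (Complex.arg (Y φ)) + cos φ * sin (Complex.arg (Y φ)) := by
      rw [cos_add, cos_sub_pi_div_two, sin_sub_pi_div_two]; ring
    have a2 : sin (φ - π / 2 + Complex.arg (Y φ)) =
        -cos φ * cos (Complex.arg (Y φ)) + sin φ * sin (Complex.arg (Y φ)) := by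
      rw [sin_add, cos_sub_pi_div_two, sin_sub_pi_div_two]
    simp only [a1, a2]
    apply Prod.ext
    · simp only [Prod.smul_fst, smul_eq_mul]
      field_simp
      linear_combination -(sin φ) * e1 - cos φ * e2 - sin φ * hsc
    · simp only [Prod.smul_snd, smul_eq_mul]
      field_simp
      linear_combination -(cos φ) * e1 + sin φ * e2 - (sin θ * cos φ + cos θ * sin φ) * hsc

namespace GoodRadius

variable (hR : GoodRadius θ A B R)
include hR

lemma strictMonoOn_ray (φ : ℝ) :
    StrictMonoOn (fun r : ℝ => Kcan (2 * cos θ) A B (r • ray θ φ)) (Icc 0 R) := by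
  intro r₁ h₁ r₂ h₂ hlt
  have hpos : 0 < r₂ := h₁.1.trans_lt hlt
  have hn : ‖toC θ (r₂ • ray θ φ)‖ = r₂ := norm_toC_smul_ray hR.sin_pos hpos.le φ
  have e1 := hR.Kcan_smul_le (z := r₂ • ray θ φ) (t := r₁ / r₂) (by rw [hn]; exact h₂.2)
    (div_nonneg h₁.1 hpos.le) (div_le_one_of_le₀ hlt.le hpos.le)
  rw [smul_smul, div_mul_cancel₀ _ hpos.ne'] at e1
  have e2 := hR.Kcan_lower (z := r₂ • ray θ φ) (by rw [hn]; exact h₂.2)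
  rw [hn] at e2
  have e3 : r₁ / r₂ < 1 := (div_lt_one hpos).2 hlt
  show Kcan (2 * cos θ) A B (r₁ • ray θ φ) < Kcan (2 * cos θ) A B (r₂ • ray θ φ)
  have e4 : 0 < Kcan (2 * cos θ) A B (r₂ • ray θ φ) := lt_of_lt_of_le (by positivity) e2
  nlinarith

/-- The elliptic polar radius of the invariant curve. -/
lemma exists_radius (hh : 0 < h) (hh' : h < R ^ 2 / 2) : ∃ r : ℝ → ℝ, Continuous r ∧
    (∀ φ, r (φ + 2 * π) = r φ) ∧ (∀ φ, r φ ∈ Ioo 0 R) ∧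
    (∀ φ, Kcan (2 * cos θ) A B (r φ • ray θ φ) = h) ∧
    ∀ φ s, s ∈ Icc 0 R → Kcan (2 * cos θ) A B (s • ray θ φ) = h → s = r φ := by
  have hex : ∀ φ, ∃ r ∈ Ioo 0 R, Kcan (2 * cos θ) A B (r • ray θ φ) = h := by
    intro φ
    have hc : ContinuousOn (fun r : ℝ => Kcan (2 * cos θ) A B (r • ray θ φ)) (Icc 0 R) :=
      Continuous.continuousOn (by fun_prop)
    have hend : h < Kcan (2 * cos θ) A B (R • ray θ φ) := by
      have hn := norm_toC_smul_ray hR.sin_pos hR.pos.le φ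
      have := hR.Kcan_lower hn.le
      rw [hn] at this
      nlinarith [hR.pos]
    obtain ⟨r, hr, hr'⟩ := intermediate_value_Ioo hR.pos.le hc
      (show h ∈ Ioo _ _ from ⟨by simpa [Kcan_zero] using hh, hend⟩)
    exact ⟨r, hr, hr'⟩
  choose r hr hKr using hex
  have huniq : ∀ φ s, s ∈ Icc 0 R → Kcan (2 * cos θ) A B (s • ray θ φ) = h → s = r φ :=
    fun φ s hs hKs => (hR.strictMonoOn_ray φ).injOn hs (Ioo_subset_Icc_self (hr φ))
      (hKs.trans (hKr φ).symm)
  refine ⟨r, ?_, fun φ => ?_, hr, hKr, huniq⟩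
  · rw [continuous_iff_continuousAt]
    intro φ
    have hcr : ∀ s : ℝ, Continuous fun φ => Kcan (2 * cos θ) A B (s • ray θ φ) := fun s =>
      (continuous_Kcan _ _ _).comp ((continuous_ray θ).const_smul s)
    -- Continuity by trapping: strict inequalities of `K` at a fixed radius `b` persist for nearby
    -- angles, and monotonicity along the rays turns them into bounds for `r`.
    refine tendsto_order.2 ⟨fun a ha => ?_, fun a ha => ?_⟩
    · obtain ⟨b, hb1, hb2⟩ := exists_between (max_lt ha (hr φ).1)
      have hb0 : 0 ≤ b := (le_max_right _ _).trans hb1.le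
      have hlt : Kcan (2 * cos θ) A B (b • ray θ φ) < h := by
        rw [← hKr φ]
        exact hR.strictMonoOn_ray φ ⟨hb0, (hb2.trans (hr φ).2).le⟩
          (Ioo_subset_Icc_self (hr φ)) hb2
      filter_upwards [((hcr b).tendsto φ).eventually_lt_const hlt] with φ' h'
      rw [← hKr φ'] at h'
      exact ((le_max_left _ _).trans_lt hb1).trans ((hR.strictMonoOn_ray φ').lt_iff_lt
        ⟨hb0, (hb2.trans (hr φ).2).le⟩ (Ioo_subset_Icc_self (hr φ')) |>.1 h')
    · obtain ⟨b, hb1, hb2⟩ := exists_between (lt_min ha (hr φ).2)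
      have hbR : b ∈ Icc 0 R :=
        ⟨((hr φ).1.trans hb1).le, hb2.le.trans (min_le_right _ _)⟩
      have hlt : h < Kcan (2 * cos θ) A B (b • ray θ φ) := by
        rw [← hKr φ]
        exact hR.strictMonoOn_ray φ (Ioo_subset_Icc_self (hr φ)) hbR hb1
      filter_upwards [((hcr b).tendsto φ).eventually_const_lt hlt] with φ' h'
      rw [← hKr φ'] at h'
      exact ((hR.strictMonoOn_ray φ').lt_iff_lt (Ioo_subset_Icc_self (hr φ')) hbR |>.1 h').trans
        (hb2.trans_le (min_le_left _ _))
  · refine huniq φ _ (Ioo_subset_Icc_self (hr _)) ?_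
    rw [← ray_add_two_pi]
    exact hKr _

end GoodRadius

lemma exp_ofReal_mul_I_eq_iff {x y : ℝ} :
    Complex.exp (x * Complex.I) = Complex.exp (y * Complex.I) ↔ ∃ n : ℤ, x = y + n * (2 * π) := by
  rw [Complex.exp_eq_exp_iff_exists_int]
  refine exists_congr fun n => ?_
  rw [show (y : ℂ) * Complex.I + n * (2 * π * Complex.I) = ((y + n * (2 * π) : ℝ) : ℂ) * Complex.I by
    push_cast; ring, mul_left_inj' Complex.I_ne_zero, Complex.ofReal_inj]

lemma isClockwiseParam_ray (hs : 0 < sin θ) {r : ℝ → ℝ} (hc : Continuous r)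
    (hper : ∀ φ, r (φ + 2 * π) = r φ) (hpos : ∀ φ, 0 < r φ) {C : Set (ℝ × ℝ)}
    (hC : C = range fun φ => r φ • ray θ φ) :
    IsClockwiseParam (fun t => r (2 * π * t) • ray θ (2 * π * t)) C 0 := by
  refine ⟨by fun_prop, fun t => ?_, ?_, ?_, ?_⟩
  · simp only [mul_add, mul_one, hper, ray_add_two_pi]
  · intro t ht t' ht' heq
    have h1 := congrArg (toC θ) heq
    simp only [toC_smul_ray hs] at h1
    have h2 := congrArg norm h1
    simp only [norm_mul, Complex.norm_exp_ofReal_mul_I, Complex.norm_real, mul_one,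
      Real.norm_of_nonneg (hpos _).le] at h2
    rw [h2, mul_right_inj' (Complex.ofReal_ne_zero.2 (hpos _).ne'), exp_ofReal_mul_I_eq_iff] at h1
    obtain ⟨n, hn⟩ := h1
    have h3 : t = t' + n := by
      have := pi_pos
      apply mul_left_cancel₀ (two_pi_pos.ne')
      linarith
    have h4 : n = 0 := by
      have e1 : (n : ℝ) < 1 := by linarith [ht.2, ht'.1]
      have e2 : (-1 : ℝ) < n := by linarith [ht.1, ht'.2]
      have e1 : n < 1 := by exact_mod_cast e1
      have e2 : -1 < n := by exact_mod_cast e2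
      omega
    rw [h3, h4]; simp
  · rw [hC]
    apply Subset.antisymm
    · rintro _ ⟨t, rfl⟩
      exact ⟨2 * π * t, rfl⟩
    · rintro _ ⟨φ, rfl⟩
      refine ⟨φ / (2 * π), ?_⟩
      simp only [mul_div_cancel₀ φ two_pi_pos.ne']
  · obtain ⟨c, ψ, hψ, hc0, hψ2, hray⟩ := exists_winding hs
    refine ⟨fun t => r (2 * π * t) * c (2 * π * t), fun t => ψ (2 * π * t), by fun_prop,
      fun t => mul_pos (hpos _) (hc0 _), fun t => ?_, fun t => ?_⟩
    · simp only [mul_add, mul_one, hψ2]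
    · simp only [hray (2 * π * t), smul_smul, zero_add]

end Curves

end McMillan

namespace McMillan

open Asymptotics Filter Topology ComplexConjugate

/-! ### The rotation number -/

section Rotation

variable {θ A B R h : ℝ}

/-- For fixed `p`, the invariant is quadratic in `q`, and the sum of the two roots on a level is
`fcan a A B p`. Thus `q ↦ -q + fcan a A B p` exchanges the roots, and `K` is symmetric in `q` and
`p`. -/
lemma Kcan_stdMap (a A B : ℝ) {z : ℝ × ℝ} (hz : 1 + B * z.2 + A * z.2 ^ 2 ≠ 0) :
    Kcan a A B (stdMap (fcan a A B) z) = Kcan a A B z := by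
  have hf : fcan a A B z.2 * (1 + B * z.2 + A * z.2 ^ 2) = z.2 * (a - B * z.2) :=
    div_mul_cancel₀ _ hz
  simp only [Kcan, K0, stdMap]
  linear_combination (fcan a A B z.2 - 2 * z.1) * hf

lemma stdMap_injective (f : ℝ → ℝ) : Function.Injective (stdMap f) := by
  intro z z' hzz
  have h1 : z.2 = z'.2 := congrArg Prod.fst hzz
  have h2 : -z.1 + f z.2 = -z'.1 + f z'.2 := congrArg Prod.snd hzz
  rw [h1] at h2
  exact Prod.ext (by linarith) h1

/-- The translation number is determined by an approximate conjugacy to a translation. -/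
lemma abs_translationNumber_sub_le (F : CircleDeg1Lift) {b : ℝ → ℝ} {b₀ m d : ℝ}
    (hb : ∀ t, |b t| ≤ b₀) (hF : ∀ t, |F t + b (F t) - (t + b t) - m| ≤ d) :
    |F.translationNumber - m| ≤ d := by
  -- The increments of `t + b t` telescope; the bounded `b` costs only `2 b₀ / n` after averaging.
  have key : ∀ n : ℕ, |(F ^ n) 0 + b ((F ^ n) 0) - b 0 - n * m| ≤ n * d := by
    intro n
    induction n with
    | zero => simp
    | succ n ih =>
      have e := hF ((F ^ n) 0)
      rw [pow_succ', CircleDeg1Lift.mul_apply]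
      rw [abs_le] at *
      push_cast
      constructor <;> linarith [e.1, e.2, ih.1, ih.2]
  have hlim := ((CircleDeg1Lift.tendsto_translation_number₀ F).sub_const m).abs
  have hlim2 : Tendsto (fun n : ℕ => d + 2 * b₀ / n) atTop (𝓝 (d + 0)) :=
    tendsto_const_nhds.add (tendsto_const_nhds.div_atTop tendsto_natCast_atTop_atTop)
  rw [add_zero] at hlim2
  refine le_of_tendsto_of_tendsto hlim hlim2 ?_
  filter_upwards [eventually_gt_atTop 0] with n hn
  have hn' : (0 : ℝ) < n := by exact_mod_cast hn
  have k := key n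
  have h1 := hb ((F ^ n) 0)
  have h2 := hb 0
  have : (F ^ n) 0 / n - m = ((F ^ n) 0 - n * m) / n := by field_simp
  rw [this, abs_div, abs_of_pos hn', div_le_iff₀ hn', add_mul, div_mul_cancel₀ _ hn'.ne']
  rw [abs_le] at *
  constructor <;> linarith [k.1, k.2, h1.1, h1.2, h2.1, h2.2]

lemma re_pos_of_norm_sub_one {x : ℂ} (hx : ‖x - 1‖ < 1) : 0 < x.re := by
  have h2 := (abs_lt.1 ((Complex.abs_re_le_norm (x - 1)).trans_lt hx)).1
  simp at h2
  linarith

lemma arg_mul_of_re_pos {x y : ℂ} (hx : 0 < x.re) (hy : 0 < y.re) :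
    Complex.arg (x * y) = Complex.arg x + Complex.arg y := by
  have hx0 : x ≠ 0 := fun h => by simp [h] at hx
  have hy0 : y ≠ 0 := fun h => by simp [h] at hy
  have h1 := abs_lt.1 (Complex.abs_arg_lt_pi_div_two_iff.2 (Or.inl hx))
  have h2 := abs_lt.1 (Complex.abs_arg_lt_pi_div_two_iff.2 (Or.inl hy))
  exact Complex.arg_mul hx0 hy0 ⟨by linarith [h1.1, h2.1], by linarith [h1.2, h2.2]⟩

lemma abs_arg_one_add_sub_im_le {x : ℂ} (hx : ‖x‖ ≤ 1 / 2) :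
    |Complex.arg (1 + x) - x.im| ≤ ‖x‖ ^ 2 := by
  have h1 := Complex.norm_log_one_add_sub_self_le (z := x) (by linarith)
  have h2 := Complex.abs_im_le_norm (Complex.log (1 + x) - x)
  rw [Complex.sub_im, Complex.log_im] at h2
  refine (h2.trans h1).trans ?_
  have h3 : (1 - ‖x‖)⁻¹ ≤ 2 := by
    rw [inv_le_comm₀ (by linarith) (by norm_num)]; linarith
  nlinarith [sq_nonneg ‖x‖]

namespace GoodRadius

variable (hR : GoodRadius θ A B R)
include hR

lemma stdMap_mem_curve (hh : 0 < h) (hh' : h < R ^ 2 / 2) {z : ℝ × ℝ}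
    (hz : Kcan (2 * cos θ) A B z = h ∧ ‖toC θ z‖ < R) :
    Kcan (2 * cos θ) A B (stdMap (fcan (2 * cos θ) A B) z) = h ∧
      ‖toC θ (stdMap (fcan (2 * cos θ) A B) z)‖ < R := by
  refine ⟨(Kcan_stdMap _ _ _ (hR.denom z hz.2.le)).trans hz.1, ?_⟩
  have h1 := hR.step z hz.2.le
  have h2 := norm_add_le (toC θ (stdMap (fcan (2 * cos θ) A B) z) - mult θ * toC θ z)
    (mult θ * toC θ z)
  rw [sub_add_cancel, norm_mul, mult, Complex.norm_exp_ofReal_mul_I, one_mul] at h2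
  rw [mult] at h1
  have h3 := hR.sq_lt_of_le hz.2.le hz.1.le
  apply lt_of_pow_lt_pow_left₀ 2 hR.pos.le
  -- The squared norm of the image is below `(5/4)² * (8/7) * (R²/2) = 25/28 * R²`.
  have h4 : ‖toC θ (stdMap (fcan (2 * cos θ) A B) z)‖ ≤ 5 / 4 * ‖toC θ z‖ := by linarith
  have := pow_le_pow_left₀ (norm_nonneg _) h4 2
  rw [mul_pow] at this
  linarith

/-- On an invariant curve, the map has a lift; its rotation number is controlled by the phase
advance in the normalized coordinate. -/
theorem exists_hasRotationNumber (hh : 0 < h) (hh' : h < R ^ 2 / 2) {m d : ℝ} (hm0 : d ≤ m)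
    (hm1 : m + d < 1)
    (hm : ∀ z, Kcan (2 * cos θ) A B z = h → ‖toC θ z‖ < R →
      0 < (nf θ A B (stdMap (fcan (2 * cos θ) A B) z) / (mult θ * nf θ A B z)).re ∧
      |θ + Complex.arg (nf θ A B (stdMap (fcan (2 * cos θ) A B) z) / (mult θ * nf θ A B z)) -
        2 * π * m| ≤ 2 * π * d) :
    ∃ ρ, HasRotationNumber (stdMap (fcan (2 * cos θ) A B)) (curve (Kcan (2 * cos θ) A B) 0 h) 0 ρ ∧
      |ρ - m| ≤ d := by
  have hs := hR.sin_pos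
  obtain ⟨r, hrc, hrp, hr, hrK, hru⟩ := hR.exists_radius hh hh'
  set M := stdMap (fcan (2 * cos θ) A B) with hM
  set K := Kcan (2 * cos θ) A B with hK
  set γ : ℝ → ℝ × ℝ := fun t => r (2 * π * t) • ray θ (2 * π * t) with hγ
  have hnγ : ∀ φ, ‖toC θ (r φ • ray θ φ)‖ = r φ := fun φ =>
    norm_toC_smul_ray hs (hr φ).1.le φ
  have hpolar : ∀ z, ∀ φ : ℝ, K z = h → ‖toC θ z‖ < R →
      toC θ z = ‖toC θ z‖ * Complex.exp (φ * Complex.I) → z = r φ • ray θ φ := by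
    intro z φ h1 h2 h3
    have e1 : z = ‖toC θ z‖ • ray θ φ := by
      apply toC_injective hs
      rw [toC_smul_ray hs]; exact h3
    have e2 := hru φ ‖toC θ z‖ ⟨norm_nonneg _, h2.le⟩ (by rw [← e1]; exact h1)
    rw [← e2]; exact e1
  have hcurve : curve K 0 h = range fun φ => r φ • ray θ φ := by
    rw [hK, hR.curve_eq hh hh']
    apply Subset.antisymm
    · rintro z ⟨h1, h2⟩
      exact ⟨Complex.arg (toC θ z), (hpolar z _ h1 h2 (Complex.norm_mul_exp_arg_mul_I _).symm).symm⟩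
    · rintro _ ⟨φ, rfl⟩
      exact ⟨hrK φ, by rw [hnγ]; exact (hr φ).2⟩
  have hparam := isClockwiseParam_ray hs hrc hrp (fun φ => (hr φ).1) hcurve
  have hγK : ∀ t, K (γ t) = h ∧ ‖toC θ (γ t)‖ < R := fun t =>
    ⟨hrK _, by rw [hγ, hnγ]; exact (hr _).2⟩
  have hMγ : ∀ t, K (M (γ t)) = h ∧ ‖toC θ (M (γ t))‖ < R := fun t =>
    hR.stdMap_mem_curve hh hh' (hγK t)
  have hne : ∀ z, K z = h → toC θ z ≠ 0 := by
    intro z hz h0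
    have : z = 0 := toC_injective hs (h0.trans (toC_zero θ).symm)
    rw [this, hK, Kcan_zero] at hz
    exact hh.ne hz
  have hmul := mult_ne_zero (θ := θ)
  have hmul1 : ‖mult θ‖ = 1 := Complex.norm_exp_ofReal_mul_I θ
  -- the angular displacement relative to the linear rotation
  set ζ : ℝ → ℂ := fun t => toC θ (M (γ t)) / (mult θ * toC θ (γ t)) with hζ
  have hζ1 : ∀ t, ‖ζ t - 1‖ < 1 := by
    intro t
    have hn := hne _ (hγK t).1
    have e : ζ t - 1 = (toC θ (M (γ t)) - mult θ * toC θ (γ t)) / (mult θ * toC θ (γ t)) := by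
      rw [hζ]; field_simp
    have hp : 0 < ‖toC θ (γ t)‖ := norm_pos_iff.2 hn
    rw [e, norm_div, norm_mul, hmul1, one_mul, div_lt_one hp]
    linarith [hR.step _ (hγK t).2.le]
  have hζre : ∀ t, 0 < (ζ t).re := fun t => re_pos_of_norm_sub_one (hζ1 t)
  have hγc : Continuous γ := hparam.continuous
  have hMc : Continuous fun t => M (γ t) := by
    have : ∀ t, 1 + B * (γ t).2 + A * (γ t).2 ^ 2 ≠ 0 := fun t => hR.denom _ (hγK t).2.le
    simp only [hM, stdMap, fcan]
    exact (by fun_prop : Continuous fun t => (γ t).2).prodMk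
      ((by fun_prop : Continuous fun t => -(γ t).1).add
        (Continuous.div (by fun_prop) (by fun_prop) this))
  have hζc : Continuous ζ :=
    ((continuous_toC θ).comp hMc).div (continuous_const.mul ((continuous_toC θ).comp hγc))
      fun t => mul_ne_zero hmul (hne _ (hγK t).1)
  have hγ1 : ∀ t, γ (t + 1) = γ t := hparam.periodic
  -- `ζ` has positive real part, so the principal argument gives a continuous lift.
  set F₀ : ℝ → ℝ := fun t => t + (θ + Complex.arg (ζ t)) / (2 * π) with hF₀
  have hF₀π : ∀ t, 2 * π * F₀ t = 2 * π * t + θ + Complex.arg (ζ t) := by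
    intro t; simp only [hF₀]; field_simp; ring
  have hF₀c : Continuous F₀ := by
    refine continuous_id.add ((continuous_const.add ?_).div_const _)
    exact continuous_iff_continuousAt.2 fun t => ContinuousAt.comp (f := ζ) (g := Complex.arg)
      (Complex.continuousAt_arg (Or.inl (hζre t))) hζc.continuousAt
  have hF₀1 : ∀ t, F₀ (t + 1) = F₀ t + 1 := by
    intro t
    have : ζ (t + 1) = ζ t := by simp only [hζ, hγ1]
    simp only [hF₀, this]; ring
  have hF₀M : ∀ t, M (γ t) = γ (F₀ t) := by
    intro t
    refine hpolar _ _ (hMγ t).1 (hMγ t).2 ?_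
    have e1 : toC θ (M (γ t)) = mult θ * toC θ (γ t) * ζ t := by
      rw [hζ]
      have := hne _ (hγK t).1
      field_simp
    have e2 : ‖toC θ (M (γ t))‖ = r (2 * π * t) * ‖ζ t‖ := by
      rw [e1, norm_mul, norm_mul, hmul1, one_mul, hγ, hnγ]
    rw [e2, hF₀π, e1]
    conv_lhs => rw [← Complex.norm_mul_exp_arg_mul_I (ζ t)]
    rw [hγ, toC_smul_ray hs, mult]
    push_cast
    rw [add_mul, add_mul, Complex.exp_add, Complex.exp_add]
    ring
  -- If `F₀ t = F₀ t'`, injectivity of `M` gives `γ t = γ t'`, hence equal displacements, hence `t =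
  -- t'`. A continuous injection commuting with the unit translation must then increase.
  have hinj : Function.Injective F₀ := by
    intro t t' htt
    have e1 : γ t = γ t' := by
      apply stdMap_injective (fcan (2 * cos θ) A B)
      show M (γ t) = M (γ t')
      rw [hF₀M, hF₀M, htt]
    have e2 : ζ t = ζ t' := by simp only [hζ, e1]
    simp only [hF₀, e2] at htt
    linarith
  have hmono : Monotone F₀ := by
    rcases hF₀c.strictMono_of_inj hinj with hm | hm
    · exact hm.monotone
    · have := hm (show (0 : ℝ) < 0 + 1 by norm_num)
      rw [hF₀1] at this
      linarith
  let F : CircleDeg1Lift := ⟨⟨F₀, hmono⟩, hF₀1⟩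
  have hFF : ∀ t, F t = F₀ t := fun t => rfl
  -- the normalized angle
  set β : ℝ → ℂ := fun t => nf θ A B (γ t) / toC θ (γ t) with hβ
  have hβ1 : ∀ t, ‖β t - 1‖ < 1 := by
    intro t
    have hn := hne _ (hγK t).1
    have e : β t - 1 = (nf θ A B (γ t) - toC θ (γ t)) / toC θ (γ t) := by
      rw [hβ]; field_simp
    have hp : 0 < ‖toC θ (γ t)‖ := norm_pos_iff.2 hn
    rw [e, norm_div, div_lt_one hp]
    linarith [hR.normal _ (hγK t).2.le]
  have hβre : ∀ t, 0 < (β t).re := fun t => re_pos_of_norm_sub_one (hβ1 t)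
  -- Passing to the normalized angle changes the advance by a coboundary. The arguments add without
  -- a `2π` correction because all factors have positive real part.
  have hadd : ∀ t, Complex.arg (ζ t) + Complex.arg (β (F₀ t)) - Complex.arg (β t) =
      Complex.arg (nf θ A B (M (γ t)) / (mult θ * nf θ A B (γ t))) := by
    intro t
    have e0 := hne _ (hγK t).1
    have e1 := hne _ (hMγ t).1
    have e2 : nf θ A B (γ t) ≠ 0 := by
      intro h0
      have := hβre t
      rw [hβ] at this
      simp [h0] at this
    have key : ζ t * β (F₀ t) = nf θ A B (M (γ t)) / (mult θ * nf θ A B (γ t)) * β t := by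
      simp only [hζ, hβ]
      rw [← hF₀M]
      field_simp
    have e3 := congrArg Complex.arg key
    rw [arg_mul_of_re_pos (hζre t) (hβre _),
      arg_mul_of_re_pos (hm _ (hγK t).1 (hγK t).2).1 (hβre t)] at e3
    linarith
  have hτ : |F.translationNumber - m| ≤ d := by
    refine abs_translationNumber_sub_le F (b := fun t => Complex.arg (β t) / (2 * π)) (b₀ := 1)
      (fun t => ?_) fun t => ?_
    · rw [abs_div, abs_of_pos two_pi_pos, div_le_one two_pi_pos]
      linarith [Complex.abs_arg_le_pi (β t), pi_pos]
    · have e := (hm _ (hγK t).1 (hγK t).2).2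
      rw [← hadd t] at e
      have e2 : F t + Complex.arg (β (F t)) / (2 * π) - (t + Complex.arg (β t) / (2 * π)) - m =
          (θ + (Complex.arg (ζ t) + Complex.arg (β (F₀ t)) - Complex.arg (β t)) - 2 * π * m) /
            (2 * π) := by
        rw [hFF]
        have := hF₀π t
        field_simp
        linear_combination this
      rw [e2, abs_div, abs_of_pos two_pi_pos, div_le_iff₀ two_pi_pos]
      linarith
  refine ⟨F.translationNumber, ⟨?_, γ, hparam, F, hF₀M, rfl⟩, hτ⟩
  rw [abs_le] at hτ
  constructor <;> linarith [hτ.1, hτ.2]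

end GoodRadius

/-- The rotation number on the curve of height `h`, to first order in `h`. -/
theorem eventually_hasRotationNumber (A B : ℝ) (h0 : 0 < θ) (hπ : θ < π) :
    ∃ C, ∀ᶠ h in 𝓝[>] (0 : ℝ), ∃ ρ, HasRotationNumber (stdMap (fcan (2 * cos θ) A B))
      (curve (Kcan (2 * cos θ) A B) 0 h) 0 ρ ∧
      |ρ - (θ + twist θ A B * h) / (2 * π)| ≤ C * (h * √h) := by
  have hs : 0 < sin θ := sin_pos_of_pos_of_lt_pi h0 hπ
  set κ := twist θ A B with hκ
  obtain ⟨C₁, hC₁, hb⟩ := (nf_stdMap_isBigO A B hs).exists_pos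
  obtain ⟨R, ⟨hR, hb⟩⟩ := ((eventually_goodRadius A B hs).and
    (eventually_radius hs hb.bound)).exists
  obtain ⟨C₂, hC₂, hK⟩ := hR.exists_Kcan_bound
  -- `L h` bounds the relative displacement `x`. The three summands of `C` come from `K0` versus
  -- `h`, from the normal form remainder, and from `arg (1 + x)` versus `x.im`.
  set L := 2 * |κ| + 6 * C₁ with hL
  set C := (|κ| * C₂ + 6 * C₁ + L ^ 2) / (2 * π) with hC
  refine ⟨C, ?_⟩
  have hev : ∀ᶠ h in 𝓝[>] (0 : ℝ), h < R ^ 2 / 2 :=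
    (eventually_lt_nhds (by have := hR.pos; positivity)).filter_mono nhdsWithin_le_nhds
  have hev2 : ∀ᶠ h in 𝓝[>] (0 : ℝ), L * h < 1 / 2 := by
    have : ContinuousAt (fun h : ℝ => L * h) 0 := by fun_prop
    exact (this.eventually_lt continuousAt_const (by simp)).filter_mono nhdsWithin_le_nhds
  have hev3 : ∀ᶠ h in 𝓝[>] (0 : ℝ), h < 1 :=
    (eventually_lt_nhds one_pos).filter_mono nhdsWithin_le_nhds
  have hev4 : ∀ᶠ h in 𝓝[>] (0 : ℝ), C * (h * √h) < (θ + κ * h) / (2 * π) := by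
    have h1 : ContinuousAt (fun h : ℝ => C * (h * √h)) 0 := by fun_prop
    have h2 : ContinuousAt (fun h : ℝ => (θ + κ * h) / (2 * π)) 0 := by fun_prop
    exact (h1.eventually_lt h2 (by simp; positivity)).filter_mono nhdsWithin_le_nhds
  have hev5 : ∀ᶠ h in 𝓝[>] (0 : ℝ), (θ + κ * h) / (2 * π) + C * (h * √h) < 1 := by
    have h1 : ContinuousAt (fun h : ℝ => (θ + κ * h) / (2 * π) + C * (h * √h)) 0 := by fun_prop
    refine (h1.eventually_lt continuousAt_const ?_).filter_mono nhdsWithin_le_nhds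
    simp only [mul_zero, add_zero, zero_mul]
    rw [div_lt_one two_pi_pos]
    linarith
  filter_upwards [hK, hev, hev2, hev3, hev4, hev5, self_mem_nhdsWithin] with
    h hK hh hh2 hh3 hh4 hh5 (hpos : 0 < h)
  refine hR.exists_hasRotationNumber hpos hh hh4.le hh5 fun z hz hzR => ?_
  have hn2 := hR.sq_lt_of_le hzR.le hz.le
  have hn2' : ‖toC θ z‖ ^ 2 ≤ 2 * h := by linarith
  have hKz := (hK z hn2').2
  rw [hz] at hKz
  have hn : ‖toC θ z‖ ≤ 3 / 2 * √h := by
    refine (sq_le_sq₀ (norm_nonneg _) (by positivity)).1 ?_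
    rw [mul_pow, sq_sqrt hpos.le]
    linarith
  have hn3 : ‖toC θ z‖ ^ 3 ≤ 3 * (h * √h) := by
    calc ‖toC θ z‖ ^ 3 = ‖toC θ z‖ ^ 2 * ‖toC θ z‖ := pow_succ _ 2
      _ ≤ 2 * h * (3 / 2 * √h) := by gcongr
      _ = 3 * (h * √h) := by ring
  have hsq1 : √h ≤ 1 := sqrt_le_one.2 hh3.le
  have hsh : √h ^ 2 = h := sq_sqrt hpos.le
  have hnz : 0 < ‖toC θ z‖ := by
    rw [norm_pos_iff]
    intro h0
    have : z = 0 := toC_injective hs (h0.trans (toC_zero θ).symm)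
    rw [this, Kcan_zero] at hz
    exact hpos.ne hz
  have hnf : 1 / 2 * ‖toC θ z‖ ≤ ‖nf θ A B z‖ := by
    have e1 := hR.normal z hzR.le
    have e2 := norm_sub_norm_le (toC θ z) (nf θ A B z)
    rw [norm_sub_rev] at e2
    linarith
  have hnf0 : nf θ A B z ≠ 0 := norm_pos_iff.1 (lt_of_lt_of_le (by positivity) hnf)
  have hmul := mult_ne_zero (θ := θ)
  have hmul1 : ‖mult θ‖ = 1 := Complex.norm_exp_ofReal_mul_I θ
  have hbz := hb z hzR.le
  set e : ℂ := (nf θ A B (stdMap (fcan (2 * cos θ) A B) z) -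
    mult θ * nf θ A B z * (1 + κ * Complex.I * K0 (2 * cos θ) z)) / (mult θ * nf θ A B z) with he
  have hen : ‖e‖ ≤ 2 * C₁ * ‖toC θ z‖ ^ 3 := by
    rw [he, norm_div, norm_mul (mult θ), hmul1, one_mul, div_le_iff₀ (norm_pos_iff.2 hnf0)]
    rw [norm_pow, norm_norm] at hbz
    calc _ ≤ C₁ * ‖toC θ z‖ ^ 4 := hbz
      _ = 2 * C₁ * ‖toC θ z‖ ^ 3 * (1 / 2 * ‖toC θ z‖) := by ring
      _ ≤ _ := by gcongr
  set x : ℂ := κ * Complex.I * K0 (2 * cos θ) z + e with hx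
  have hq : nf θ A B (stdMap (fcan (2 * cos θ) A B) z) / (mult θ * nf θ A B z) = 1 + x := by
    rw [hx, he]; field_simp; ring
  rw [← norm_toC_sq] at hx
  have hen2 : ‖e‖ ≤ 6 * C₁ * (h * √h) := by
    calc ‖e‖ ≤ 2 * C₁ * ‖toC θ z‖ ^ 3 := hen
      _ ≤ 2 * C₁ * (3 * (h * √h)) := by gcongr
      _ = _ := by ring
  have hhs : h * √h ≤ h := by nlinarith
  have hxn : ‖x‖ ≤ L * h := by
    have e1 : ‖(κ : ℂ) * Complex.I * ((‖toC θ z‖ ^ 2 : ℝ) : ℂ)‖ = |κ| * ‖toC θ z‖ ^ 2 := by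
      rw [norm_mul, norm_mul, Complex.norm_I, mul_one, Complex.norm_real, Complex.norm_real,
        Real.norm_eq_abs, Real.norm_of_nonneg (sq_nonneg _)]
    calc ‖x‖ ≤ |κ| * ‖toC θ z‖ ^ 2 + ‖e‖ := by
          rw [hx]; exact (norm_add_le _ _).trans_eq (by rw [e1])
      _ ≤ |κ| * (2 * h) + 6 * C₁ * h := by
          gcongr
          exact hen2.trans (by gcongr)
      _ = L * h := by rw [hL]; ring
  have hxim : |x.im - κ * h| ≤ (|κ| * C₂ + 6 * C₁) * (h * √h) := by
    have e1 : x.im - κ * h = -(κ * (h - ‖toC θ z‖ ^ 2)) + e.im := by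
      rw [hx]
      simp only [Complex.add_im, Complex.im_mul_ofReal, Complex.im_ofReal_mul, Complex.I_im]
      ring
    rw [e1]
    refine (abs_add_le _ _).trans ?_
    rw [abs_neg, abs_mul, add_mul]
    have := (Complex.abs_im_le_norm e).trans hen2
    have : |κ| * |h - ‖toC θ z‖ ^ 2| ≤ |κ| * C₂ * (h * √h) := by
      rw [mul_assoc]; gcongr
    linarith
  rw [hq]
  constructor
  · exact re_pos_of_norm_sub_one (by rw [add_sub_cancel_left]; linarith)
  · have e1 := abs_arg_one_add_sub_im_le (x := x) (by linarith)
    have e2 : ‖x‖ ^ 2 ≤ L ^ 2 * (h * √h) := by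
      calc ‖x‖ ^ 2 ≤ (L * h) ^ 2 := by gcongr
        _ = L ^ 2 * (h * h) := by ring
        _ ≤ L ^ 2 * (h * √h) := by
          have : h ≤ √h := by nlinarith [sqrt_nonneg h]
          gcongr
    have e3 : θ + Complex.arg (1 + x) - 2 * π * ((θ + κ * h) / (2 * π)) =
        (Complex.arg (1 + x) - x.im) + (x.im - κ * h) := by
      field_simp; ring
    have e4 : 2 * π * (C * (h * √h)) = (|κ| * C₂ + 6 * C₁ + L ^ 2) * (h * √h) := by
      rw [hC]; field_simp
    rw [e3, e4]
    refine (abs_add_le _ _).trans ?_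
    linarith

end Rotation

end McMillan

namespace McMillan

open Asymptotics Filter Topology MeasureTheory

/-! ### From the asymptotic expansions to the detuning -/

section Detuning

variable {θ A B R h t : ℝ}

namespace GoodRadius

variable (hR : GoodRadius θ A B R)
include hR

lemma action_pos (hh : 0 < h) (hh' : h < R ^ 2 / 2) : 0 < action (Kcan (2 * cos θ) A B) 0 h := by
  rw [hR.action_eq hh hh']
  refine div_pos (ENNReal.toReal_pos ?_ hR.volume_well_ne_top) two_pi_pos
  exact (isOpen_well.measure_pos volume ⟨0, hR.zero_mem_well hh⟩).ne'

/-- With `t³ = x / y` one gets `J x ≤ t² J y < J y`. -/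
lemma strictMonoOn_action :
    StrictMonoOn (action (Kcan (2 * cos θ) A B) 0) (Ioo 0 (R ^ 2 / 2)) := by
  intro x hx y hy hxy
  have h0 : 0 < x / y := div_pos hx.1 hy.1
  have h1 : x / y < 1 := (div_lt_one hy.1).2 hxy
  set t := (x / y) ^ (1 / 3 : ℝ) with ht
  have ht0 : 0 < t := rpow_pos_of_pos h0 _
  have ht1 : t < 1 := rpow_lt_one h0.le h1 (by norm_num)
  have ht3 : t ^ 3 * y = x := by
    rw [ht, ← rpow_natCast, ← rpow_mul h0.le]
    norm_num
    exact div_mul_cancel₀ _ hy.1.ne'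
  have := hR.action_le_sq_mul hy.1 hy.2 ht0 ht1.le
  rw [ht3] at this
  nlinarith [hR.action_pos hy.1 hy.2, mul_pos ht0 (sub_pos.2 ht1)]

/-- The scaling bound `t² J h ≤ J (t h)`, applied on either side of `x`, gives `|J y - J x| ≤
|(y/x)² - 1| J x`. -/
lemma continuousOn_action :
    ContinuousOn (action (Kcan (2 * cos θ) A B) 0) (Ioo 0 (R ^ 2 / 2)) := by
  intro x hx
  set J := action (Kcan (2 * cos θ) A B) 0 with hJ
  refine ContinuousAt.continuousWithinAt ?_
  have hJx := hR.action_pos hx.1 hx.2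
  have hb : ∀ᶠ y in 𝓝 x, |J y - J x| ≤ |(y / x) ^ 2 - 1| * J x := by
    filter_upwards [Ioo_mem_nhds hx.1 hx.2] with y hy
    have hmono := hR.strictMonoOn_action.monotoneOn
    have hx0 := hx.1.ne'
    have hy0 := hy.1.ne'
    rcases le_total y x with hyx | hyx
    · have e1 := hmono hy hx hyx
      have e2 := hR.sq_mul_action_le hx.1 hx.2 (div_pos hy.1 hx.1) ((div_le_one hx.1).2 hyx)
      rw [div_mul_cancel₀ _ hx0] at e2
      have e3 : (y / x) ^ 2 ≤ 1 :=
        pow_le_one₀ (div_pos hy.1 hx.1).le ((div_le_one hx.1).2 hyx)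
      rw [abs_of_nonpos (by linarith), abs_of_nonpos (by linarith)]
      linarith
    · have e1 := hmono hx hy hyx
      have e2 := hR.sq_mul_action_le hy.1 hy.2 (div_pos hx.1 hy.1) ((div_le_one hy.1).2 hyx)
      rw [div_mul_cancel₀ _ hy0, div_pow, div_mul_eq_mul_div, div_le_iff₀ (pow_pos hy.1 2)] at e2
      have e3 : 1 ≤ (y / x) ^ 2 := one_le_pow₀ ((one_le_div hx.1).2 hyx)
      rw [abs_of_nonneg (by linarith), abs_of_nonneg (by linarith), sub_mul, one_mul, div_pow,
        div_mul_eq_mul_div]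
      gcongr
      rw [le_div_iff₀ (pow_pos hx.1 2)]
      linarith
  rw [ContinuousAt, tendsto_iff_norm_sub_tendsto_zero]
  refine squeeze_zero' (Eventually.of_forall fun _ => norm_nonneg _) hb ?_
  have hc : Continuous fun y => |(y / x) ^ 2 - 1| * J x := by fun_prop
  have := hc.tendsto x
  simpa [div_self hx.1.ne'] using this

end GoodRadius

lemma mul_sqrt_isLittleO : (fun x : ℝ => x * √x) =o[𝓝 0] fun x => x := by
  have h : (fun x : ℝ => √x) =o[𝓝 0] fun _ => (1 : ℝ) := by
    rw [isLittleO_one_iff]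
    have := continuous_sqrt.tendsto (0 : ℝ)
    rwa [sqrt_zero] at this
  simpa using (isBigO_refl (fun x : ℝ => x) (𝓝 0)).mul_isLittleO h

/-- The action is inverted as a function of height; both expansions have error `h^(3/2)`, which is
`o(J)` since `h ≤ 2 σ J`. -/
theorem hasDetuning_of_expansions {M : ℝ × ℝ → ℝ × ℝ} {K : ℝ × ℝ → ℝ} {z₀ : ℝ × ℝ}
    {ν₀ c σ h₁ C₁ C₂ : ℝ} (hfix : M z₀ = z₀) (hσ : 0 < σ) (h₁pos : 0 < h₁)
    (hmono : StrictMonoOn (action K z₀) (Ioo 0 h₁)) (hcont : ContinuousOn (action K z₀) (Ioo 0 h₁))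
    (hC₁ : 0 ≤ C₁) (hJ : ∀ᶠ h in 𝓝[>] (0 : ℝ), |σ * action K z₀ h - h| ≤ C₁ * (h * √h))
    (hρ : ∀ᶠ h in 𝓝[>] (0 : ℝ), ∃ ρ, HasRotationNumber M (curve K z₀ h) z₀ ρ ∧
      |ρ - (ν₀ + c * h)| ≤ C₂ * (h * √h)) :
    HasDetuning M K z₀ ν₀ (c * σ) := by
  set J := action K z₀ with hJdef
  have hev : ∀ᶠ h in 𝓝[>] (0 : ℝ), C₁ * √h < 1 / 2 := by
    have : ContinuousAt (fun h => C₁ * √h) 0 := by fun_prop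
    exact (this.eventually_lt continuousAt_const (by simp)).filter_mono nhdsWithin_le_nhds
  have hev2 : ∀ᶠ h in 𝓝[>] (0 : ℝ), h < h₁ :=
    (eventually_lt_nhds h₁pos).filter_mono nhdsWithin_le_nhds
  obtain ⟨h₀, h₀pos, hall⟩ := mem_nhdsGT_iff_exists_Ioc_subset.1
    ((hJ.and hρ).and (hev.and hev2))
  have h₀pos : 0 < h₀ := h₀pos
  have hb : ∀ h ∈ Ioc 0 h₀, |σ * J h - h| ≤ C₁ * (h * √h) := fun h hh => (hall hh).1.1
  have hhalf : ∀ h ∈ Ioc 0 h₀, |σ * J h - h| ≤ h / 2 := fun h hh => by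
    have e2 : C₁ * √h < 1 / 2 := (hall hh).2.1
    refine (hb h hh).trans ?_
    nlinarith [hh.1]
  have hlt : ∀ h ∈ Ioc 0 h₀, h < h₁ := fun h hh => (hall hh).2.2
  have hsub : Ioc 0 h₀ ⊆ Ioo 0 h₁ := fun h hh => ⟨hh.1, hlt h hh⟩
  have hJpos : ∀ h ∈ Ioc 0 h₀, 0 < J h := fun h hh => by
    have := (abs_le.1 (hhalf h hh)).1
    have : 0 < σ * J h := by linarith [hh.1]
    exact pos_of_mul_pos_right this hσ.le
  have h₀mem : h₀ ∈ Ioc 0 h₀ := ⟨h₀pos, le_rfl⟩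
  have hbij : BijOn J (Ioo 0 h₀) (Ioo 0 (J h₀)) := by
    refine ⟨fun h hh => ⟨hJpos h (Ioo_subset_Ioc_self hh),
      hmono (hsub (Ioo_subset_Ioc_self hh)) (hsub h₀mem) hh.2⟩,
      hmono.injOn.mono fun h hh => hsub (Ioo_subset_Ioc_self hh), fun y hy => ?_⟩
    -- A height whose action is below `y`, because `σ J x ≤ 3/2 x ≤ 3/4 σ y`; the intermediate value
    -- theorem applies between `x` and `h₀`.
    set x := min (h₀ / 2) (σ * y / 2) with hx
    have hx0 : 0 < x := lt_min (by linarith) (by have := mul_pos hσ hy.1; linarith)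
    have hxh : x < h₀ := (min_le_left _ _).trans_lt (by linarith)
    have hxy : J x < y := by
      have e1 := (abs_le.1 (hhalf x ⟨hx0, hxh.le⟩)).2
      have e2 : x ≤ σ * y / 2 := min_le_right _ _
      have : σ * J x < σ * y := by
        have := mul_pos hσ hy.1
        linarith
      exact lt_of_mul_lt_mul_left this hσ.le
    obtain ⟨h, hh, hhy⟩ := intermediate_value_Ioo hxh.le
      (hcont.mono fun h hh => hsub ⟨hx0.trans_le hh.1, hh.2⟩) (⟨hxy, hy.2⟩ : y ∈ Ioo _ _)
    exact ⟨h, ⟨hx0.trans hh.1, hh.2⟩, hhy⟩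
  have hch : ∀ h, ∃ ρ, h ∈ Ioo 0 h₀ → HasRotationNumber M (curve K z₀ h) z₀ ρ ∧
      |ρ - (ν₀ + c * h)| ≤ C₂ * (h * √h) := by
    intro h
    by_cases hh : h ∈ Ioo 0 h₀
    · obtain ⟨ρ, hρ⟩ := (hall (Ioo_subset_Ioc_self hh)).1.2
      exact ⟨ρ, fun _ => hρ⟩
    · exact ⟨0, fun h' => absurd h' hh⟩
  choose ρ hρ using hch
  classical
  set g := Function.invFunOn J (Ioo 0 h₀) with hg
  -- Outside the range of actions the value is `ν₀`, which supplies `ν 0`; only small `j ≥ 0` matter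
  -- for the derivative.
  set ν : ℝ → ℝ := fun j => if j ∈ Ioo 0 (J h₀) then ρ (g j) else ν₀ with hν
  have hinv : ∀ h ∈ Ioo 0 h₀, g (J h) = h := fun h hh => hbij.injOn.leftInvOn_invFunOn hh
  have hinv2 : ∀ j ∈ Ioo 0 (J h₀), J (g j) = j ∧ g j ∈ Ioo 0 h₀ := fun j hj => by
    obtain ⟨h, hh, rfl⟩ := hbij.surjOn hj
    rw [hinv h hh]
    exact ⟨rfl, hh⟩
  have hν0 : ν 0 = ν₀ := if_neg fun h => lt_irrefl _ h.1
  refine ⟨hfix, h₀, h₀pos, J h₀, hJpos h₀ h₀mem, ν, hbij, fun h hh => ?_, hν0, ?_⟩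
  · have : ν (J h) = ρ h := by
      rw [hν]
      simp only [if_pos (hbij.mapsTo hh), hinv h hh]
    rw [this]
    exact (hρ h hh).1
  · rw [hasDerivWithinAt_iff_isLittleO]
    have hbig : (fun j => ν j - ν 0 - (j - 0) • (c * σ)) =O[𝓝[Ici 0] 0] fun j => j * √j := by
      refine IsBigO.of_bound ((|C₂| + |c| * C₁) * (2 * σ * √(2 * σ))) ?_
      have hnear : ∀ᶠ j in 𝓝[Ici 0] (0 : ℝ), j < J h₀ :=
        (eventually_lt_nhds (hJpos h₀ h₀mem)).filter_mono nhdsWithin_le_nhds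
      filter_upwards [hnear, self_mem_nhdsWithin] with j hj1 (hj0 : 0 ≤ j)
      rcases hj0.eq_or_lt with rfl | hj0
      · simp
      have hj : j ∈ Ioo 0 (J h₀) := ⟨hj0, hj1⟩
      obtain ⟨e1, e2⟩ := hinv2 j hj
      have e3 : ν j = ρ (g j) := if_pos hj
      have b1 := (hρ _ e2).2
      have b2 := hb _ (Ioo_subset_Ioc_self e2)
      have b3 := (abs_le.1 (hhalf _ (Ioo_subset_Ioc_self e2))).1
      rw [e1] at b2 b3
      set x := g j with hx
      have hx2 : x ≤ 2 * σ * j := by linarith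
      have hxs : x * √x ≤ 2 * σ * √(2 * σ) * (j * √j) := by
        calc x * √x ≤ (2 * σ * j) * √(2 * σ * j) := by gcongr
          _ = _ := by rw [sqrt_mul (by positivity)]; ring
      have hxpos : 0 ≤ x * √x := mul_nonneg e2.1.le (sqrt_nonneg _)
      rw [hν0, e3, smul_eq_mul, sub_zero, Real.norm_eq_abs, Real.norm_of_nonneg (by positivity)]
      have key : ρ x - ν₀ - j * (c * σ) = (ρ x - (ν₀ + c * x)) + -(c * (σ * j - x)) := by ring
      rw [key, mul_assoc]
      calc _ ≤ |ρ x - (ν₀ + c * x)| + |c| * |σ * j - x| := by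
            refine (abs_add_le _ _).trans_eq ?_
            rw [abs_neg, abs_mul]
        _ ≤ |C₂| * (x * √x) + |c| * (C₁ * (x * √x)) := by
            gcongr
            exact b1.trans (mul_le_mul_of_nonneg_right (le_abs_self _) hxpos)
        _ = (|C₂| + |c| * C₁) * (x * √x) := by ring
        _ ≤ _ := by gcongr
    refine (hbig.trans_isLittleO (mul_sqrt_isLittleO.mono nhdsWithin_le_nhds)).congr_right
      fun j => (sub_zero j).symm

lemma stdMap_fcan_zero (a A B : ℝ) : stdMap (fcan a A B) 0 = 0 := by
  simp [stdMap, fcan]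

/-- The detuning of the canonical family at the origin. -/
theorem hasDetuning_Kcan (a A B : ℝ) (h1 : -2 < a) (h2 : a < 2) :
    HasDetuning (stdMap (fcan a A B)) (Kcan a A B) 0 (tune a)
      (1 / (2 * π) * (3 * A * a / (4 - a ^ 2) -
        B ^ 2 * ((1 + a) * (8 + a) / ((2 + a) * (2 - a) ^ 2)))) := by
  set θ := arccos (a / 2) with hθ
  have hcos : 2 * cos θ = a := by
    rw [hθ, cos_arccos (by linarith) (by linarith)]; ring
  have h0 : 0 < θ := arccos_pos.2 (by linarith)
  have hπ : θ < π := by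
    refine (arccos_le_pi _).lt_of_ne fun h => ?_
    rw [← hθ] at h
    rw [h, cos_pi] at hcos
    linarith
  have hs : 0 < sin θ := sin_pos_of_pos_of_lt_pi h0 hπ
  obtain ⟨R, hR⟩ := (eventually_goodRadius A B hs).exists
  obtain ⟨C₁, hC₁, hJ⟩ := hR.exists_action_bound
  obtain ⟨C₂, hρ⟩ := eventually_hasRotationNumber A B h0 hπ
  have hR0 := hR.pos
  have main := hasDetuning_of_expansions (ν₀ := θ / (2 * π)) (c := twist θ A B / (2 * π))
    (C₂ := C₂) (stdMap_fcan_zero _ _ _) (by positivity : 0 < 2 * sin θ)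
    (by positivity : 0 < R ^ 2 / 2) hR.strictMonoOn_action hR.continuousOn_action hC₁ hJ (by
      filter_upwards [hρ] with h ⟨ρ, h1, h2⟩
      refine ⟨ρ, h1, ?_⟩
      rwa [add_div, mul_div_right_comm] at h2)
  have hc : twist θ A B / (2 * π) * (2 * sin θ) = 1 / (2 * π) * (3 * A * a / (4 - a ^ 2) -
      B ^ 2 * ((1 + a) * (8 + a) / ((2 + a) * (2 - a) ^ 2))) := by
    rw [twist, hcos]
    field_simp
  rw [hc, hcos] at main
  exact main

/-! ### Change of origin and of scale -/

lemma IsClockwiseParam.translate {γ : ℝ → ℝ × ℝ} {C : Set (ℝ × ℝ)} (hγ : IsClockwiseParam γ C 0)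
    (z₀ : ℝ × ℝ) : IsClockwiseParam (fun t => z₀ + γ t) ((fun z => z₀ + z) '' C) z₀ := by
  obtain ⟨r, φ, h1, h2, h3, h4⟩ := hγ.winding
  refine ⟨continuous_const.add hγ.continuous, fun t => by simp only [hγ.periodic t],
    fun t ht t' ht' h => hγ.injOn ht ht' (add_left_cancel h), ?_, r, φ, h1, h2, h3, fun t => ?_⟩
  · rw [← hγ.range_eq, ← range_comp]; rfl
  · rw [h4 t, zero_add]

/-- The factor `g` only relabels heights, `h ↦ h / g`. The regions are translates, so areas, actions
and rotation numbers agree, and the same function `ν` serves. -/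
theorem HasDetuning.translate {M M' : ℝ × ℝ → ℝ × ℝ} {K K' : ℝ × ℝ → ℝ} {z₀ : ℝ × ℝ}
    {ν₀ c g : ℝ} (hd : HasDetuning M K 0 ν₀ c) (hg : 0 < g) (hM : ∀ z, M' (z₀ + z) = z₀ + M z)
    (hK : ∀ z, K' (z₀ + z) = K' z₀ + g * (K z - K 0)) : HasDetuning M' K' z₀ ν₀ c := by
  have hreg : ∀ h, region K' z₀ h = (Homeomorph.addLeft z₀) '' region K 0 (h / g) := by
    intro h
    have hiff : ∀ z, K' (z₀ + z) < K' z₀ + h ↔ K z < K 0 + h / g := by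
      intro z
      rw [hK, add_lt_add_iff_left, ← lt_div_iff₀' hg, sub_lt_iff_lt_add']
    have hset : {z | K' z < K' z₀ + h} = (Homeomorph.addLeft z₀) '' {z | K z < K 0 + h / g} := by
      ext z
      constructor
      · intro hz
        refine ⟨-z₀ + z, (hiff _).1 ?_, add_neg_cancel_left z₀ z⟩
        rwa [add_neg_cancel_left]
      · rintro ⟨w, hw, rfl⟩
        exact (hiff w).2 hw
    rw [region, region]
    by_cases hx : (0 : ℝ × ℝ) ∈ {z | K z < K 0 + h / g}
    · rw [Homeomorph.image_connectedComponentIn _ hx, hset]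
      simp
    · have hx' : z₀ ∉ {z | K' z < K' z₀ + h} := fun h' => hx ((hiff 0).1 (by simpa using h'))
      rw [connectedComponentIn_eq_empty hx, connectedComponentIn_eq_empty hx', image_empty]
  have hcur : ∀ h, curve K' z₀ h = (fun z => z₀ + z) '' curve K 0 (h / g) := by
    intro h
    rw [curve, curve, hreg, ← Homeomorph.image_frontier]
    rfl
  have hact : ∀ h, action K' z₀ h = action K 0 (h / g) := by
    intro h
    rw [action, action, hreg]
    simp
  obtain ⟨hfix, h₀, h₀pos, δ, hδ, ν, hbij, hrot, hν0, hder⟩ := hd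
  refine ⟨by simpa [hfix] using hM 0, g * h₀, by positivity, δ, hδ, ν, ?_, fun h hh => ?_, hν0, hder⟩
  · have : action K' z₀ = action K 0 ∘ fun h => h / g := funext hact
    rw [this]
    refine hbij.comp ⟨fun h hh => ⟨div_pos hh.1 hg, (div_lt_iff₀' hg).2 hh.2⟩,
      fun x _ y _ h => (div_left_inj' hg.ne').1 h, fun y hy => ⟨g * y, ⟨mul_pos hg hy.1, ?_⟩, ?_⟩⟩
    · exact mul_lt_mul_of_pos_left hy.2 hg
    · exact mul_div_cancel_left₀ y hg.ne'
  · rw [hact, hcur]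
    obtain ⟨hρ, γ, hγ, F, hF, hτ⟩ := hrot (h / g) ⟨div_pos hh.1 hg, (div_lt_iff₀' hg).2 hh.2⟩
    exact ⟨hρ, _, hγ.translate z₀, F, fun t => by rw [hM, hF], hτ⟩

end Detuning

end McMillan

namespace McMillan

/-! ### The particular maps -/

section Particular

variable {a : ℝ}

theorem hasDetuning_foctPlus (h1 : -2 < a) (h2 : a < 2) :
    HasDetuning (stdMap (foctPlus a)) (KoctPlus a) 0 (tune a)
      (3 / (2 * π) * (a / (4 - a ^ 2))) := by
  have hf : foctPlus a = fcan a 1 0 := by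
    funext p
    simp [foctPlus, fcan, mul_comm]
  have hK : KoctPlus a = Kcan a 1 0 := by
    funext z
    simp [KoctPlus, Kcan]
  rw [hf, hK]
  convert hasDetuning_Kcan a 1 0 h1 h2 using 1
  field_simp
  ring

theorem hasDetuning_foctMinus (h1 : -2 < a) (h2 : a < 2) :
    HasDetuning (stdMap (foctMinus a)) (KoctMinus a) 0 (tune a)
      (-(3 / (2 * π) * (a / (4 - a ^ 2)))) := by
  have hf : foctMinus a = fcan a (-1) 0 := by
    funext p
    simp [foctMinus, fcan, mul_comm, sub_eq_add_neg]
  have hK : KoctMinus a = Kcan a (-1) 0 := by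
    funext z
    simp [KoctMinus, Kcan, sub_eq_add_neg]
  rw [hf, hK]
  convert hasDetuning_Kcan a (-1) 0 h1 h2 using 1
  field_simp
  ring

theorem hasDetuning_fsxt (h1 : -2 < a) (h2 : a < 2) :
    HasDetuning (stdMap (fsxt a)) (Ksxt a) 0 (tune a)
      (-(1 / (2 * π)) * ((1 + a) * (8 + a) / ((2 + a) * (2 - a) ^ 2))) := by
  have hf : fsxt a = fcan a 0 1 := by
    funext p
    rw [fsxt, fcan, ← mul_div_assoc]
    congr 1 <;> ring
  have hK : Ksxt a = Kcan a 0 1 := by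
    funext z
    simp [Ksxt, Kcan]
  rw [hf, hK]
  convert hasDetuning_Kcan a 0 1 h1 h2 using 1
  ring

lemma tune_duffing (a : ℝ) : tune (8 / a - 2) = tuneDuffing a := by
  rw [tune, tuneDuffing]
  congr 2
  ring

/-- The detuning at the symmetric fixed points `(s, s)` with `2 s² = a - 2`. -/
theorem hasDetuning_duffing (ha : 2 < a) {s : ℝ} (hs : 2 * s ^ 2 = a - 2) :
    HasDetuning (stdMap (foctPlus a)) (KoctPlus a) (s, s) (tuneDuffing a)
      (1 / (2 * π) * ((4 + a) / (a * (2 - a)))) := by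
  have ha0 : 0 < a := by linarith
  have h8 : 8 / a < 4 := by rw [div_lt_iff₀ ha0]; linarith
  have h8' : 0 < 8 / a := by positivity
  -- Expanding `KoctPlus a` at `(s, s)` the linear terms vanish, and the pure squares have
  -- coefficient `1 + s² = a / 2`. Division by it leaves trace `8 / a - 2`, cubic coefficient `4 s /
  -- a` and quartic coefficient `2 / a`. The sign of `s` drops out, as only `B²` enters the
  -- detuning.
  have main := hasDetuning_Kcan (8 / a - 2) (2 / a) (4 * s / a) (by linarith) (by linarith)
  rw [tune_duffing a] at main
  have hs2 : s ^ 2 = (a - 2) / 2 := by linarith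
  have hc : 1 / (2 * π) * ((4 + a) / (a * (2 - a))) =
      1 / (2 * π) * (3 * (2 / a) * (8 / a - 2) / (4 - (8 / a - 2) ^ 2) -
        (4 * s / a) ^ 2 * ((1 + (8 / a - 2)) * (8 + (8 / a - 2)) /
          ((2 + (8 / a - 2)) * (2 - (8 / a - 2)) ^ 2))) := by
    have e1 : 4 - (8 / a - 2) ^ 2 = 32 * (a - 2) / a ^ 2 := by field_simp; ring
    have e2 : 2 - (8 / a - 2) = 4 * (a - 2) / a := by field_simp; ring
    have e3 : 2 + (8 / a - 2) = 8 / a := by ring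
    have e4 : a - 2 ≠ 0 := by linarith
    have e5 : 2 - a = -(a - 2) := by ring
    rw [e1, e2, e3, e5, div_pow, mul_pow, hs2]
    congr 1
    field_simp
    ring
  rw [hc]
  refine main.translate (g := a / 2) (by positivity) (fun z => ?_) fun z => ?_
  · have hd : 1 + (s + z.2) ^ 2 = a / 2 * (1 + 4 * s / a * z.2 + 2 / a * z.2 ^ 2) := by
      field_simp
      linear_combination hs
    have hd0 : 0 < 1 + 4 * s / a * z.2 + 2 / a * z.2 ^ 2 := by
      have : 0 < a / 2 * (1 + 4 * s / a * z.2 + 2 / a * z.2 ^ 2) := by rw [← hd]; positivity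
      exact pos_of_mul_pos_right this (by positivity)
    have hf : foctPlus a (s + z.2) = 2 * s + fcan (8 / a - 2) (2 / a) (4 * s / a) z.2 := by
      rw [foctPlus, fcan, hd, ← sub_eq_iff_eq_add', div_sub' (by positivity),
        div_eq_div_iff (by positivity) hd0.ne']
      field_simp
      linear_combination (-4 * a * z.2 - 8 * z.2 ^ 3 - 16 * s * z.2 ^ 2) * hs
    apply Prod.ext
    · rfl
    · simp only [stdMap, Prod.snd_add, Prod.fst_add, hf]
      ring
  · simp only [KoctPlus, Kcan, K0, Prod.snd_add, Prod.fst_add, Prod.fst_zero, Prod.snd_zero]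
    field_simp
    linear_combination (z.1 ^ 2 + z.2 ^ 2 + 2 * s * (z.1 + z.2) + 4 * z.1 * z.2) * hs

/-! ### ### Trigonometric forms of the detunings -/

lemma two_pi_mul_tune (a : ℝ) : 2 * π * tune a = arccos (a / 2) := by
  rw [tune]; field_simp

lemma cos_tune (h1 : -2 < a) (h2 : a < 2) : cos (2 * π * tune a) = a / 2 := by
  rw [two_pi_mul_tune, cos_arccos (by linarith) (by linarith)]

lemma sin_tune_pos (h1 : -2 < a) (h2 : a < 2) : 0 < sin (2 * π * tune a) := by
  rw [two_pi_mul_tune, sin_arccos]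
  apply sqrt_pos.2
  nlinarith

lemma sin_sq_tune (h1 : -2 < a) (h2 : a < 2) : sin (2 * π * tune a) ^ 2 = (4 - a ^ 2) / 4 := by
  rw [sin_sq, cos_tune h1 h2]; ring

lemma cos_sq_half_tune (h1 : -2 < a) (h2 : a < 2) : cos (π * tune a) ^ 2 = (2 + a) / 4 := by
  have := cos_tune h1 h2
  rw [mul_assoc, cos_two_mul] at this
  linarith

lemma sin_sq_half_tune (h1 : -2 < a) (h2 : a < 2) : sin (π * tune a) ^ 2 = (2 - a) / 4 := by
  rw [sin_sq, cos_sq_half_tune h1 h2]; ring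

lemma detuning_octupole_eq (h1 : -2 < a) (h2 : a < 2) :
    3 / (2 * π) * (a / (4 - a ^ 2)) =
      3 / (4 * π) * (cot (2 * π * tune a) / sin (2 * π * tune a)) := by
  have hne : 4 - a ^ 2 ≠ 0 := by nlinarith
  rw [cot_eq_cos_div_sin, div_div, ← sq, sin_sq_tune h1 h2, cos_tune h1 h2]
  field_simp

lemma detuning_sextupole_eq (h1 : -2 < a) (h2 : a < 2) :
    -(1 / (2 * π)) * ((1 + a) * (8 + a) / ((2 + a) * (2 - a) ^ 2)) =
      -(1 / (32 * π)) *
        ((8 * sin (2 * π * tune a) + sin (4 * π * tune a)) /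
          (sin (π * tune a) ^ 3 * sin (2 * π * tune a) ^ 3)) * sin (3 * π * tune a) := by
  have hs := sin_tune_pos h1 h2
  have hs2 := sin_sq_half_tune h1 h2
  have e2 := sin_sq_tune h1 h2
  have e4 : sin (4 * π * tune a) = a * sin (2 * π * tune a) := by
    rw [show 4 * π * tune a = 2 * (2 * π * tune a) by ring, sin_two_mul, cos_tune h1 h2]; ring
  have e3 : sin (3 * π * tune a) = (1 + a) * sin (π * tune a) := by
    rw [show 3 * π * tune a = 3 * (π * tune a) by ring, sin_three_mul]
    linear_combination (-4 * sin (π * tune a)) * hs2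
  have hs1 : sin (π * tune a) ≠ 0 := by
    intro h0
    rw [h0] at hs2
    linarith
  rw [e4, e3]
  set x := sin (π * tune a)
  set y := sin (2 * π * tune a)
  have hy := hs.ne'
  -- From `x² = (2 - a) / 4` and `y² = (2 - a) (2 + a) / 4`; the remaining `x y` of the cubes
  -- cancels against the two sine factors.
  have hA : (2 + a) * (2 - a) ^ 2 = 16 * (x ^ 2 * y ^ 2) := by rw [hs2, e2]; ring
  rw [hA]
  field_simp
  ring

lemma detuning_duffing_eq (ha : 2 < a) :
    1 / (2 * π) * ((4 + a) / (a * (2 - a))) =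
      -(1 / (4 * π)) * ((2 + cos (2 * π * tuneDuffing a)) / tan (π * tuneDuffing a) ^ 2) := by
  have ha0 : 0 < a := by linarith
  have h8 : 8 / a < 4 := by rw [div_lt_iff₀ ha0]; linarith
  have h8' : 0 < 8 / a := by positivity
  have h1 : -2 < 8 / a - 2 := by linarith
  have h2 : 8 / a - 2 < 2 := by linarith
  rw [← tune_duffing a, tan_eq_sin_div_cos, div_pow, cos_tune h1 h2, sin_sq_half_tune h1 h2,
    cos_sq_half_tune h1 h2]
  have e1 : 2 - (8 / a - 2) = 4 * (a - 2) / a := by field_simp; ring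
  have e2 : 2 + (8 / a - 2) = 8 / a := by ring
  have e4 : a - 2 ≠ 0 := by linarith
  have e5 : 2 - a = -(a - 2) := by ring
  rw [e1, e2, e5]
  field_simp
  ring

end Particular

end McMillan

theorem mainTheorem6 :
    -- focusing (FO) and defocusing (DO) octupoles
    (∀ a : ℝ, -2 < a → a < 2 →
      McMillan.HasDetuning (McMillan.stdMap (McMillan.foctPlus a)) (McMillan.KoctPlus a) 0
        (McMillan.tune a) (3 / (2 * π) * (a / (4 - a ^ 2))) ∧
      McMillan.HasDetuning (McMillan.stdMap (McMillan.foctMinus a)) (McMillan.KoctMinus a) 0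
        (McMillan.tune a) (-(3 / (2 * π) * (a / (4 - a ^ 2)))) ∧
      3 / (2 * π) * (a / (4 - a ^ 2)) =
        3 / (4 * π) *
          (Real.cot (2 * π * McMillan.tune a) / Real.sin (2 * π * McMillan.tune a))) ∧
    -- sextupole (SX)
    (∀ a : ℝ, -2 < a → a < 2 →
      McMillan.HasDetuning (McMillan.stdMap (McMillan.fsxt a)) (McMillan.Ksxt a) 0
        (McMillan.tune a)
        (-(1 / (2 * π)) * ((1 + a) * (8 + a) / ((2 + a) * (2 - a) ^ 2))) ∧
      -(1 / (2 * π)) * ((1 + a) * (8 + a) / ((2 + a) * (2 - a) ^ 2)) =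
        -(1 / (32 * π)) *
          ((8 * Real.sin (2 * π * McMillan.tune a) + Real.sin (4 * π * McMillan.tune a)) /
            (Real.sin (π * McMillan.tune a) ^ 3 * Real.sin (2 * π * McMillan.tune a) ^ 3)) *
          Real.sin (3 * π * McMillan.tune a)) ∧
    -- Duffing regime (Df) of the focusing octupole, around either of the two stable fixed points
    (∀ a : ℝ, 2 < a →
      McMillan.HasDetuning (McMillan.stdMap (McMillan.foctPlus a)) (McMillan.KoctPlus a)
        (McMillan.duffingPoint a) (McMillan.tuneDuffing a)
        (1 / (2 * π) * ((4 + a) / (a * (2 - a)))) ∧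
      McMillan.HasDetuning (McMillan.stdMap (McMillan.foctPlus a)) (McMillan.KoctPlus a)
        (-McMillan.duffingPoint a) (McMillan.tuneDuffing a)
        (1 / (2 * π) * ((4 + a) / (a * (2 - a)))) ∧
      1 / (2 * π) * ((4 + a) / (a * (2 - a))) =
        -(1 / (4 * π)) *
          ((2 + Real.cos (2 * π * McMillan.tuneDuffing a)) /
            Real.tan (π * McMillan.tuneDuffing a) ^ 2)) := by
  refine ⟨fun a h1 h2 => ⟨McMillan.hasDetuning_foctPlus h1 h2, McMillan.hasDetuning_foctMinus h1 h2,
      McMillan.detuning_octupole_eq h1 h2⟩,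
    fun a h1 h2 => ⟨McMillan.hasDetuning_fsxt h1 h2, McMillan.detuning_sextupole_eq h1 h2⟩,
    fun a ha => ⟨?_, ?_, McMillan.detuning_duffing_eq ha⟩⟩
  · refine McMillan.hasDetuning_duffing ha ?_
    rw [Real.sq_sqrt (by linarith)]
    ring
  · refine McMillan.hasDetuning_duffing ha (s := -√((a - 2) / 2)) ?_
    rw [neg_sq, Real.sq_sqrt (by linarith)]
    ring
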